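/- **Notation.** For real $\rho>0$, $\beta\ge 0$, $\gamma$ and $z$ let $$E^{\gamma}_{\rho,\beta}(z)=\sum_{k=0}^{\infty}\frac{(\gamma)_k}{\Gamma(\rho k+\beta)}\,\frac{z^k}{k!},\qquad (\gamma)_k=\gamma(\gamma+1)\cdots(\gamma+k-1),\quad \tfrac1{\Gamma(0)}=0 .$$ For $\beta>0$ and $\omega\in\mathbb R$ the Prabhakar integral is $$\mathbf E^{\gamma}_{\rho,\beta,\omega,0^+}f(t)=\int_0^t (t-y)^{\beta-1}E^{\gamma}_{\rho,\beta}(\omega(t-y)^\rho)f(y)\,dy ,$$ and for order $\beta=0$ it is read as its limit for $\beta\to0^+$, $$\mathbf E^{\gamma}_{\rho,0,\omega,0^+}f(t)=f(t)+\int_0^t (t-y)^{-1}E^{\gamma}_{\rho,0}(\omega(t-y)^\rho)f(y)\,dy ,$$ so that $\mathbf E^{0}_{\rho,0,\omega,0^+}f=f$. For $0<\mu\le1$ and $\nu\in[0,1]$ the regularized Hilfer-Prabhakar derivative of order $\mu$ of a locally absolutely continuous $f$ is $${}^C\mathbf D^{\gamma,\mu}_{\rho,\omega,0^+}f=\mathbf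 E^{-\gamma\nu}_{\rho,\nu(1-\mu),\omega,0^+}\,\mathbf E^{-\gamma(1-\nu)}_{\rho,(1-\nu)(1-\mu),\omega,0^+}\,\frac{d}{dt}f$$ (it does not depend on $\nu$, and equals $\mathbf E^{-\gamma}_{\rho,1-\mu,\omega,0^+}f'$; the theorem below is asserted for the displayed form with every $\nu\in[0,1]$). **Theorem 4.2.** Let $0<\rho\le1$, $0<\mu\le1$, $\gamma\ge0$, $\lambda>0$, $\omega\in\mathbb R$, and let $v\in\mathbb C$ with $|v|\le1$. For every $t\ge0$ the series $$G(v,t)=\sum_{n=0}^{\infty}(-\lambda)^n(1-v)^n\,t^{n\mu}\,E^{n\gamma}_{\rho,n\mu+1}(-\omega t^\rho)$$ converges absolutely, and $t\mapsto G(v,t)$ is the solution of the Cauchy problem $${}^C\mathbf D^{\gamma,\mu}_{\rho,-\omega,0^+}G(v,t)=-\lambda(1-v)G(v,t)\quad(t>0),\qquad G(v,0)=1 .$$ More precisely: 1. $G(v,\cdot)$ is absolutely continuous on $[0,b]$ for every $b>0$ and differentiable at every $t>0$, the integrals in the regularized derivative of $G(v,\cdot)$ converge absolutely at every $t>0$,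 the equation holds at every $t>0$, and $G(v,0)=1$. 2. For every $b>0$, if $g:[0,b]\to\mathbb C$ is absolutely continuous with $g(0)=1$ and ${}^C\mathbf D^{\gamma,\mu}_{\rho,-\omega,0^+}g(t)=-\lambda(1-v)g(t)$ for almost every $t\in(0,b)$, then $g(t)=G(v,t)$ for all $t\in[0,b]$. -/

import Mathlib

open MeasureTheory Set

noncomputable section

/-- The three-parameter (Prabhakar) Mittag-Leffler function
`E_{α,β}^γ(z) = ∑ₖ (γ)ₖ / (Γ(αk+β) k!) zᵏ`. The quotient `Γ(γ+k)/Γ(γ)` is written as the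
Pochhammer symbol `(γ)ₖ = γ(γ+1)⋯(γ+k-1)`, which also gives it its meaning at the poles of `Γ`.
At a pole of `Γ` one has `(Real.Gamma s)⁻¹ = 0`, the value of the entire function `1/Γ`. -/
def mittagLeffler (α β γ z : ℝ) : ℝ :=
  ∑' k : ℕ, (ascPochhammer ℝ k).eval γ * (Real.Gamma (α * k + β))⁻¹ * z ^ k / (k.factorial : ℝ)

/-- The Prabhakar kernel `e_{ρ,μ,ω}^γ(t) = t^{μ-1} E_{ρ,μ}^γ(ω t^ρ)`, used for `t > 0`. -/
def prabhakarKernel (ρ μ ω γ t : ℝ) : ℝ :=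
  t ^ (μ - 1) * mittagLeffler ρ μ γ (ω * t ^ ρ)

/-- The integral defining the Prabhakar integral of `f` at `t` converges absolutely. -/
def PrabhakarConverges (ρ μ ω γ : ℝ) (f : ℝ → ℂ) (t : ℝ) : Prop :=
  IntervalIntegrable (fun y => (prabhakarKernel ρ μ ω γ (t - y) : ℂ) * f y) volume 0 t

/-- The Prabhakar integral `∫₀ᵗ (t-y)^{μ-1} E_{ρ,μ}^γ(ω (t-y)^ρ) f(y) dy` of order `μ > 0`.
At order `μ = 0` it is its limit as `μ → 0⁺`, namely
`f(t) + ∫₀ᵗ (t-y)^{-1} E_{ρ,0}^γ(ω (t-y)^ρ) f(y) dy`: the `k = 0` term of the kernel degenerates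
to a Dirac mass at `0`, while `E_{ρ,0}^γ` has no constant term. For `γ = 0` this is the
convention that the operator `E_{ρ,0,ω}^0` is the identity. -/
def prabhakarIntegral (ρ μ ω γ : ℝ) (f : ℝ → ℂ) (t : ℝ) : ℂ :=
  (if μ = 0 then f t else 0) + ∫ y in (0 : ℝ)..t, (prabhakarKernel ρ μ ω γ (t - y) : ℂ) * f y

/-- The regularized Hilfer-Prabhakar derivative of `f` at `t`, in the form
`E_{ρ,ν(1-μ),ω}^{-γν} E_{ρ,(1-ν)(1-μ),ω}^{-γ(1-ν)} f'`. For `ν = 0` or `ν = 1` one of the two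
operators is the identity (if `μ < 1`) and this is the form `E_{ρ,1-μ,ω}^{-γ} f'`. -/
def regularizedHilferPrabhakar (ρ ω γ μ ν : ℝ) (f : ℝ → ℂ) (t : ℝ) : ℂ :=
  prabhakarIntegral ρ (ν * (1 - μ)) ω (-γ * ν)
    (prabhakarIntegral ρ ((1 - ν) * (1 - μ)) ω (-γ * (1 - ν)) (deriv f)) t

/-- The regularized Hilfer-Prabhakar derivative of `f` exists at every `t > 0`: the ordinary
derivative exists there and both integrals converge absolutely. -/
def RegularizedHilferPrabhakarExists (ρ ω γ μ ν : ℝ) (f : ℝ → ℂ) : Prop :=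
  ∀ t : ℝ, 0 < t → DifferentiableAt ℝ f t ∧
    PrabhakarConverges ρ ((1 - ν) * (1 - μ)) ω (-γ * (1 - ν)) (deriv f) t ∧
    PrabhakarConverges ρ (ν * (1 - μ)) ω (-γ * ν)
      (prabhakarIntegral ρ ((1 - ν) * (1 - μ)) ω (-γ * (1 - ν)) (deriv f)) t

/-- The `n`-th term `(-λ)ⁿ (1-v)ⁿ t^{nμ} E_{ρ,nμ+1}^{nγ}(-ω t^ρ)`. -/
def solutionTerm (ρ ω γ μ lam : ℝ) (v : ℂ) (t : ℝ) (n : ℕ) : ℂ :=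
  (-(lam : ℂ)) ^ n * (1 - v) ^ n *
    ((t ^ (n * μ) * mittagLeffler ρ (n * μ + 1) (n * γ) (-ω * t ^ ρ) : ℝ) : ℂ)

/-- `G(v,t) = ∑ₙ (-λ)ⁿ (1-v)ⁿ t^{nμ} E_{ρ,nμ+1}^{nγ}(-ω t^ρ)`. -/
def solutionSeries (ρ ω γ μ lam : ℝ) (v : ℂ) (t : ℝ) : ℂ :=
  ∑' n : ℕ, solutionTerm ρ ω γ μ lam v t n

end

/-! Write `e(β,x)` for the Prabhakar kernel of order `β` and third parameter `x`, and `c = -λ(1-v)`.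
Expanded in powers, `e(β,x) = ∑ⱼ (x)ⱼ/j! ωʲ s^(ρj+β-1)/Γ(ρj+β)`. Convolving two Riemann-Liouville
kernels adds their orders (beta integral), and the coefficients `(x)ⱼ/j!` obey Chu-Vandermonde, so
`e(β,x) * e(β',x') = e(β+β', x+x')`, with a Dirac mass added at order zero (`prabhakarKernel_conv`).

Existence: `G = ∑ cⁿ e(1+nμ, nγ)` and `G' = c ∑ cⁿ e(μ+nμ, γ+nγ)`. The two operators of the
derivative together add `1-μ` to the order and subtract `γ` from the parameter, which turns `G'`
into `c G` (`prabhakarIntegral_prabhakarSeries`).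

Uniqueness: convolving the equation with `e(μ,γ)` produces total order `1` and total parameter `0`
in front of `g'`. That kernel is the constant `1`, so `g - g(0) = c e(μ,γ) * g`. The difference of
two solutions is then a fixed point of a Volterra operator with integrable kernel, and vanishes
(`eqOn_zero_of_eq_causalConv`).

All convergence rests on `A^s/Γ(s) ≤ (A+1)exp(A+1)`, uniformly in `s ≥ 0` with `A` free
(`rpow_mul_inv_Gamma_le`), and on `|(x)ⱼ/j!| ≤ 2^(N+j)` for `|x| ≤ N`. Every series is dominated by
a geometric one whose ratio is made small by taking `A` large. -/

noncomputable section

/-! ### Bounds on `1/Γ` and on the coefficients `(x)ⱼ/j!` -/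

/-- The Riemann-Liouville kernel `t^{a-1} / Γ(a)`; it vanishes for `a = 0`. -/
def rlKernel (a t : ℝ) : ℝ := t ^ (a - 1) * (Real.Gamma a)⁻¹

/-- The binomial-type coefficient `(x)ⱼ / j!`. -/
def pochhammerCoeff (x : ℝ) (j : ℕ) : ℝ := (ascPochhammer ℝ j).eval x / (j.factorial : ℝ)

end

theorem rlKernel_zero (t : ℝ) : rlKernel 0 t = 0 := by simp [rlKernel, Real.Gamma_zero]

theorem rlKernel_nonneg {a t : ℝ} (ha : 0 ≤ a) (ht : 0 ≤ t) : 0 ≤ rlKernel a t :=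
  mul_nonneg (Real.rpow_nonneg ht _) (inv_nonneg.2 (Real.Gamma_nonneg_of_nonneg ha))

/-- On `(A, A+1]` the integrand `exp(-x) x^(s-1)` of `Γ(s)` is at least `exp(-(A+1)) A^s/(A+1)`, and
the interval has length one. This replaces Stirling's formula. -/
theorem rpow_mul_inv_Gamma_le {A s : ℝ} (hA : 0 < A) (hs : 0 ≤ s) :
    A ^ s * (Real.Gamma s)⁻¹ ≤ (A + 1) * Real.exp (A + 1) := by
  rcases hs.eq_or_lt with rfl | hs
  · simp only [Real.Gamma_zero, inv_zero, mul_zero]; positivity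
  have hG := Real.Gamma_pos_of_pos hs
  rw [← div_eq_mul_inv, div_le_iff₀ hG]
  have hint := Real.GammaIntegral_convergent hs
  have hsub : Ioc A (A + 1) ⊆ Ioi 0 := fun x hx => hA.trans hx.1
  have h1 : ∫ x in Ioc A (A + 1), Real.exp (-x) * x ^ (s - 1) ≤ Real.Gamma s := by
    rw [Real.Gamma_eq_integral hs]
    refine setIntegral_mono_set hint ?_ (ae_of_all _ hsub)
    filter_upwards [ae_restrict_mem measurableSet_Ioi] with x hx
    exact mul_nonneg (Real.exp_pos _).le (Real.rpow_nonneg (le_of_lt hx) _)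
  have h2 : ∫ x in Ioc A (A + 1), A ^ s * (Real.exp (-(A + 1)) / (A + 1)) ≤
      ∫ x in Ioc A (A + 1), Real.exp (-x) * x ^ (s - 1) := by
    refine setIntegral_mono_on (integrableOn_const (by simp)) (hint.mono_set hsub) measurableSet_Ioc ?_
    intro x hx
    have hx0 : 0 < x := hA.trans hx.1
    rw [Real.rpow_sub_one hx0.ne']
    have e1 : A ^ s ≤ x ^ s := Real.rpow_le_rpow hA.le hx.1.le hs.le
    have e2 : Real.exp (-(A + 1)) ≤ Real.exp (-x) := Real.exp_le_exp.2 (by linarith [hx.2])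
    have e3 : (A + 1)⁻¹ ≤ x⁻¹ := inv_anti₀ hx0 hx.2
    calc A ^ s * (Real.exp (-(A + 1)) / (A + 1))
        = Real.exp (-(A + 1)) * (A ^ s * (A + 1)⁻¹) := by ring
      _ ≤ Real.exp (-x) * (x ^ s * x⁻¹) := by gcongr
      _ = _ := by ring
  have h3 : ∫ x in Ioc A (A + 1), A ^ s * (Real.exp (-(A + 1)) / (A + 1)) =
      A ^ s * (Real.exp (-(A + 1)) / (A + 1)) := by
    simp
  rw [h3] at h2
  have h4 := h2.trans h1
  have hA1 : 0 < A + 1 := by linarith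
  calc A ^ s = (A + 1) * Real.exp (A + 1) * (A ^ s * (Real.exp (-(A + 1)) / (A + 1))) := by
        rw [Real.exp_neg]; field_simp
    _ ≤ _ := by gcongr

theorem abs_ascPochhammer_eval_le {x y : ℝ} (h : |x| ≤ y) (j : ℕ) :
    |(ascPochhammer ℝ j).eval x| ≤ (ascPochhammer ℝ j).eval y := by
  have hy : 0 ≤ y := (abs_nonneg x).trans h
  induction j with
  | zero => simp
  | succ j ih =>
    rw [ascPochhammer_succ_eval, ascPochhammer_succ_eval, abs_mul]
    refine mul_le_mul ih ((abs_add_le _ _).trans (by simpa using h)) (abs_nonneg _)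
      ((abs_nonneg _).trans ih)

/-- At the integer `N` the coefficient is the binomial `C(N+j-1, j)`. The dependence on `N` is kept
explicit because the parameter later grows linearly with the index of the outer series. -/
theorem abs_pochhammerCoeff_le {x : ℝ} {N : ℕ} (h : |x| ≤ N) (j : ℕ) :
    |pochhammerCoeff x j| ≤ 2 ^ N * 2 ^ j := by
  rw [pochhammerCoeff, abs_div, Nat.abs_cast, div_le_iff₀ (by positivity)]
  refine (abs_ascPochhammer_eval_le h j).trans ?_
  rw [← ascPochhammer_eval_cast, ascPochhammer_nat_eq_ascFactorial, ← pow_add]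
  have h1 := Nat.ascFactorial_eq_factorial_mul_choose' N j
  have h2 : (N + j - 1).choose j ≤ 2 ^ (N + j) :=
    (Nat.choose_le_two_pow _ _).trans (Nat.pow_le_pow_right (by norm_num) (by omega))
  rw [h1]
  push_cast
  rw [mul_comm]
  gcongr
  exact_mod_cast h2

/-- Chu-Vandermonde, transported from falling factorials by `(z)ₖ = (-1)ᵏ (-z)(-z-1)⋯(-z-k+1)`. -/
theorem sum_antidiagonal_pochhammerCoeff (x y : ℝ) (n : ℕ) :
    ∑ p ∈ Finset.HasAntidiagonal.antidiagonal n, pochhammerCoeff x p.1 * pochhammerCoeff y p.2 =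
      pochhammerCoeff (x + y) n := by
  have key : ∀ (z : ℝ) (k : ℕ), (ascPochhammer ℝ k).eval z =
      (-1) ^ k * (descPochhammer ℤ k).smeval (-z) := by
    intro z k
    rw [← Polynomial.ascPochhammer_smeval_eq_eval, ← neg_neg z,
      Polynomial.ascPochhammer_smeval_neg_eq_descPochhammer, neg_neg, Int.negOnePow_def]
    simp [Units.smul_def]
  have hV := Ring.descPochhammer_smeval_add (r := -x) (s := -y) n (Commute.all _ _)
  rw [pochhammerCoeff, key, neg_add, hV, Finset.mul_sum, Finset.sum_div]
  refine Finset.sum_congr rfl fun p hp => ?_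
  have hp' := Finset.HasAntidiagonal.mem_antidiagonal.1 hp
  subst hp'
  rw [pochhammerCoeff, pochhammerCoeff, key, key, Nat.choose_symm_add, Nat.add_choose, Nat.cast_div
    (Nat.factorial_mul_factorial_dvd_factorial_add _ _) (by positivity)]
  push_cast
  field_simp
  ring

/-! ### Beta integrals and convolution of Riemann-Liouville kernels -/

theorem intervalIntegrable_sub_rpow_mul_rpow {a b t : ℝ} (ha : 0 < a) (hb : 0 < b) (ht : 0 < t) :
    IntervalIntegrable (fun y => (t - y) ^ (a - 1) * y ^ (b - 1)) volume 0 t := by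
  have left : ∀ a b : ℝ, 0 < b →
      IntervalIntegrable (fun y => (t - y) ^ (a - 1) * y ^ (b - 1)) volume 0 (t / 2) := by
    intro a b hb
    refine IntervalIntegrable.continuousOn_mul
      (intervalIntegral.intervalIntegrable_rpow' (by linarith)) ?_
    refine ContinuousOn.rpow_const (by fun_prop) fun x hx => Or.inl ?_
    rw [uIcc_of_le (by positivity)] at hx
    have := hx.2
    linarith
  refine (left a b hb).trans ?_
  -- On `[0, t/2]` only the factor at `0` is singular; the reflection `y ↦ t - y` with exchanged
  -- exponents gives the other half.
  have h := ((left b a ha).comp_sub_left t).symm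
  rw [sub_half, sub_zero] at h
  refine h.congr fun y _ => ?_
  simp only [sub_sub_cancel]
  ring

theorem integral_sub_rpow_mul_rpow {a b t : ℝ} (ha : 0 < a) (hb : 0 < b) (ht : 0 < t) :
    ∫ y in (0 : ℝ)..t, (t - y) ^ (a - 1) * y ^ (b - 1) =
      t ^ (a + b - 1) * (Real.Gamma a * Real.Gamma b * (Real.Gamma (a + b))⁻¹) := by
  have h := Complex.betaIntegral_scaled (b : ℂ) (a : ℂ) ht
  rw [Complex.betaIntegral_eq_Gamma_mul_div _ _ (by simpa) (by simpa)] at h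
  have e : ∫ x in (0 : ℝ)..t, (x : ℂ) ^ ((b : ℂ) - 1) * ((t : ℂ) - x) ^ ((a : ℂ) - 1) =
      ((∫ y in (0 : ℝ)..t, (t - y) ^ (a - 1) * y ^ (b - 1) : ℝ) : ℂ) := by
    rw [← intervalIntegral.integral_ofReal]
    refine intervalIntegral.integral_congr fun y hy => ?_
    rw [uIcc_of_le ht.le] at hy
    rw [Complex.ofReal_mul, Complex.ofReal_cpow hy.1, Complex.ofReal_cpow (by linarith [hy.2])]
    push_cast
    ring
  rw [e, ← Complex.ofReal_add, Complex.Gamma_ofReal, Complex.Gamma_ofReal, Complex.Gamma_ofReal,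
    ← Complex.ofReal_one, ← Complex.ofReal_sub, ← Complex.ofReal_cpow ht.le] at h
  have h' : ∫ y in (0 : ℝ)..t, (t - y) ^ (a - 1) * y ^ (b - 1) =
      t ^ (b + a - 1) * (Real.Gamma b * Real.Gamma a / Real.Gamma (b + a)) := by
    exact_mod_cast h
  rw [h', add_comm b a]
  ring

theorem intervalIntegrable_rlKernel_mul {a b t : ℝ} (ha : 0 ≤ a) (hb : 0 < b) (ht : 0 < t) :
    IntervalIntegrable (fun y => rlKernel a (t - y) * rlKernel b y) volume 0 t := by
  rcases ha.eq_or_lt with rfl | ha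
  · simpa only [rlKernel_zero, zero_mul] using
      (intervalIntegrable_const : IntervalIntegrable (fun _ : ℝ => (0 : ℝ)) volume 0 t)
  · refine ((intervalIntegrable_sub_rpow_mul_rpow ha hb ht).mul_const
      ((Real.Gamma a)⁻¹ * (Real.Gamma b)⁻¹)).congr fun y _ => ?_
    simp only [rlKernel]
    ring

theorem integral_rlKernel_mul {a b t : ℝ} (ha : 0 < a) (hb : 0 < b) (ht : 0 < t) :
    ∫ y in (0 : ℝ)..t, rlKernel a (t - y) * rlKernel b y = rlKernel (a + b) t := by
  have e : ∀ y, rlKernel a (t - y) * rlKernel b y =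
      (t - y) ^ (a - 1) * y ^ (b - 1) * ((Real.Gamma a)⁻¹ * (Real.Gamma b)⁻¹) := fun y => by
    simp only [rlKernel]; ring
  simp only [e]
  rw [intervalIntegral.integral_mul_const, integral_sub_rpow_mul_rpow ha hb ht, rlKernel]
  have h1 := (Real.Gamma_pos_of_pos ha).ne'
  have h2 := (Real.Gamma_pos_of_pos hb).ne'
  field_simp

/-! ### Expansion, size and continuity of the Prabhakar kernel -/

open Filter Topology in
theorem eventually_mul_div_rpow_le (K T : ℝ) {ρ ε : ℝ} (hρ : 0 < ρ) (hε : 0 < ε) :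
    ∀ᶠ A : ℝ in atTop, K * (T / A) ^ ρ ≤ ε := by
  have h1 : Tendsto (fun A : ℝ => T / A) atTop (𝓝 0) := tendsto_const_nhds.div_atTop tendsto_id
  have h2 : Tendsto (fun A : ℝ => K * (T / A) ^ ρ) atTop (𝓝 (K * 0 ^ ρ)) :=
    ((Real.continuousAt_rpow_const 0 ρ (Or.inr hρ.le)).tendsto.comp h1).const_mul K
  rw [Real.zero_rpow hρ.ne', mul_zero] at h2
  exact (h2.eventually (gt_mem_nhds hε)).mono fun _ h => le_of_lt h

noncomputable section

/-- The constant bounding `A ^ s / Γ(s)` for all `s ≥ 0`. -/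
def gammaBound (A : ℝ) : ℝ := (A + 1) * Real.exp (A + 1)

/-- The `j`-th term of the series of the Prabhakar kernel. -/
def prabhakarTerm (ρ μ ω γ t : ℝ) (j : ℕ) : ℝ :=
  pochhammerCoeff γ j * ω ^ j * rlKernel (ρ * j + μ) t

end

theorem gammaBound_nonneg {A : ℝ} (hA : 0 < A) : 0 ≤ gammaBound A := by
  unfold gammaBound; positivity

theorem rlKernel_le {A s t : ℝ} (hA : 0 < A) (hs : 0 ≤ s) (ht : 0 < t) :
    rlKernel s t ≤ gammaBound A * ((t / A) ^ s / t) := by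
  have h := rpow_mul_inv_Gamma_le hA hs
  have hAs := Real.rpow_pos_of_pos hA s
  have e : rlKernel s t = (A ^ s * (Real.Gamma s)⁻¹) * ((t / A) ^ s / t) := by
    rw [rlKernel, Real.rpow_sub_one ht.ne', Real.div_rpow ht.le hA.le]
    field_simp
  rw [e]
  exact mul_le_mul_of_nonneg_right h (by positivity)

/-- The bound on `1/Γ` is exponential in the order `ρj + μ`, hence geometric in `j`. -/
theorem abs_prabhakarTerm_le {ρ μ γ ω A t : ℝ} {N : ℕ} (hρ : 0 < ρ) (hμ : 0 ≤ μ) (hN : |γ| ≤ N)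
    (hA : 0 < A) (ht : 0 < t) (j : ℕ) :
    |prabhakarTerm ρ μ ω γ t j| ≤
      gammaBound A * 2 ^ N * ((t / A) ^ μ / t) * (2 * |ω| * (t / A) ^ ρ) ^ j := by
  have hs : 0 ≤ ρ * j + μ := by positivity
  have htA : 0 < t / A := div_pos ht hA
  rw [prabhakarTerm, abs_mul, abs_mul, abs_pow, abs_of_nonneg (rlKernel_nonneg hs ht.le)]
  have hC := gammaBound_nonneg hA
  calc |pochhammerCoeff γ j| * |ω| ^ j * rlKernel (ρ * j + μ) t
      ≤ 2 ^ N * 2 ^ j * |ω| ^ j * (gammaBound A * ((t / A) ^ (ρ * j + μ) / t)) := by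
        gcongr
        · exact rlKernel_nonneg hs ht.le
        · exact abs_pochhammerCoeff_le hN j
        · exact rlKernel_le hA hs ht
    _ = _ := by
        rw [Real.rpow_add htA, Real.rpow_mul htA.le, Real.rpow_natCast]
        ring

theorem summable_abs_prabhakarTerm {ρ μ t : ℝ} (ω γ : ℝ) (hρ : 0 < ρ) (hμ : 0 ≤ μ) (ht : 0 < t) :
    Summable fun j => |prabhakarTerm ρ μ ω γ t j| := by
  obtain ⟨N, hN⟩ := exists_nat_ge |γ|
  obtain ⟨A, hA, hq⟩ := ((Filter.eventually_gt_atTop 0).and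
    (eventually_mul_div_rpow_le (2 * |ω|) t hρ one_half_pos)).exists
  refine Summable.of_nonneg_of_le (fun _ => abs_nonneg _)
    (abs_prabhakarTerm_le hρ hμ hN hA ht) (Summable.mul_left _ ?_)
  exact summable_geometric_of_lt_one (by positivity) (by linarith)

theorem hasSum_prabhakarTerm {ρ μ t : ℝ} (ω γ : ℝ) (hρ : 0 < ρ) (hμ : 0 ≤ μ) (ht : 0 < t) :
    HasSum (prabhakarTerm ρ μ ω γ t) (prabhakarKernel ρ μ ω γ t) := by
  have hs : Summable (prabhakarTerm ρ μ ω γ t) :=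
    (summable_abs_prabhakarTerm ω γ hρ hμ ht).of_abs
  convert hs.hasSum using 1
  rw [prabhakarKernel, mittagLeffler, ← tsum_mul_left]
  refine tsum_congr fun j => ?_
  rw [prabhakarTerm, pochhammerCoeff, rlKernel, mul_pow, ← Real.rpow_natCast (t ^ ρ),
    ← Real.rpow_mul ht.le, add_sub_assoc, Real.rpow_add ht]
  ring

/-- The constants depend on the order only through `(t/A)^μ` and on the parameter only through
`2^N`; this makes the later sum over kernels of growing order and parameter geometric too. -/
theorem abs_prabhakarKernel_le {ρ μ γ ω A t : ℝ} {N : ℕ} (hρ : 0 < ρ) (hμ : 0 ≤ μ)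
    (hN : |γ| ≤ N) (hA : 0 < A) (ht : 0 < t) (hq : 2 * |ω| * (t / A) ^ ρ ≤ 1 / 2) :
    |prabhakarKernel ρ μ ω γ t| ≤ 2 * gammaBound A * 2 ^ N * ((t / A) ^ μ / t) := by
  have hgeo : HasSum (fun j : ℕ => gammaBound A * 2 ^ N * ((t / A) ^ μ / t) * (1 / 2) ^ j)
      (gammaBound A * 2 ^ N * ((t / A) ^ μ / t) * 2) := hasSum_geometric_two.mul_left _
  have htA : 0 < t / A := div_pos ht hA
  have hC := gammaBound_nonneg hA
  have h := tsum_of_norm_bounded hgeo (f := prabhakarTerm ρ μ ω γ t) fun j => by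
    rw [Real.norm_eq_abs]
    refine (abs_prabhakarTerm_le hρ hμ hN hA ht j).trans ?_
    gcongr
  rw [(hasSum_prabhakarTerm ω γ hρ hμ ht).tsum_eq, Real.norm_eq_abs] at h
  linarith

/-- At order zero the general bound is the non-integrable `1/t`. Since `1/Γ(0) = 0` the term `j = 0`
is absent, and the series starts with the integrable size `t^(ρ-1)`. -/
theorem abs_prabhakarKernel_zero_le {ρ γ ω A t : ℝ} {N : ℕ} (hρ : 0 < ρ)
    (hN : |γ| ≤ N) (hA : 0 < A) (ht : 0 < t) (hq : 2 * |ω| * (t / A) ^ ρ ≤ 1 / 2) :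
    |prabhakarKernel ρ 0 ω γ t| ≤ 4 * gammaBound A * 2 ^ N * |ω| * ((t / A) ^ ρ / t) := by
  have htA : 0 < t / A := div_pos ht hA
  have hC := gammaBound_nonneg hA
  have h0 : prabhakarTerm ρ 0 ω γ t 0 = 0 := by simp [prabhakarTerm, rlKernel_zero]
  have hsum := (hasSum_nat_add_iff' 1).2 (hasSum_prabhakarTerm ω γ hρ le_rfl ht)
  rw [Finset.sum_range_one, h0, sub_zero] at hsum
  have hgeo : HasSum (fun j : ℕ => gammaBound A * 2 ^ N * (1 / t) *
      (2 * |ω| * (t / A) ^ ρ) * (1 / 2) ^ j)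
      (gammaBound A * 2 ^ N * (1 / t) * (2 * |ω| * (t / A) ^ ρ) * 2) :=
    hasSum_geometric_two.mul_left _
  have h := tsum_of_norm_bounded hgeo (f := fun j => prabhakarTerm ρ 0 ω γ t (j + 1)) fun j => by
    rw [Real.norm_eq_abs]
    refine (abs_prabhakarTerm_le hρ le_rfl hN hA ht (j + 1)).trans ?_
    rw [Real.rpow_zero, pow_succ', ← mul_assoc]
    gcongr
  rw [hsum.tsum_eq, Real.norm_eq_abs] at h
  refine h.trans (le_of_eq ?_)
  ring

theorem exists_abs_prabhakarKernel_le {ρ μ : ℝ} (ω γ : ℝ) (hρ : 0 < ρ) (hμ : 0 ≤ μ) (T : ℝ) :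
    ∃ M a : ℝ, 0 ≤ M ∧ 0 < a ∧
      ∀ t, 0 < t → t ≤ T → |prabhakarKernel ρ μ ω γ t| ≤ M * t ^ (a - 1) := by
  obtain ⟨N, hN⟩ := exists_nat_ge |γ|
  obtain ⟨A, hA, hq⟩ := ((Filter.eventually_gt_atTop 0).and
    (eventually_mul_div_rpow_le (2 * |ω|) T hρ one_half_pos)).exists
  have hC := gammaBound_nonneg hA
  have hq' : ∀ t, 0 < t → t ≤ T → 2 * |ω| * (t / A) ^ ρ ≤ 1 / 2 := fun t ht htT =>
    le_trans (by gcongr) hq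
  have e : ∀ a t : ℝ, 0 < t → (t / A) ^ a / t = (A ^ a)⁻¹ * t ^ (a - 1) := fun a t ht => by
    rw [Real.rpow_sub_one ht.ne', Real.div_rpow ht.le hA.le]; ring
  -- The exponent is `ρ` at order zero and `μ` otherwise, so the singularity is integrable in both
  -- cases.
  rcases hμ.eq_or_lt with rfl | hμ
  · refine ⟨4 * gammaBound A * 2 ^ N * |ω| * (A ^ ρ)⁻¹, ρ, by positivity, hρ, fun t ht htT => ?_⟩
    have h := abs_prabhakarKernel_zero_le hρ hN hA ht (hq' t ht htT)
    rwa [e ρ t ht, ← mul_assoc] at h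
  · refine ⟨2 * gammaBound A * 2 ^ N * (A ^ μ)⁻¹, μ, by positivity, hμ, fun t ht htT => ?_⟩
    have h := abs_prabhakarKernel_le hρ hμ.le hN hA ht (hq' t ht htT)
    rwa [e μ t ht, ← mul_assoc] at h

theorem continuousOn_prabhakarKernel {ρ μ : ℝ} (ω γ : ℝ) (hρ : 0 < ρ) (hμ : 0 ≤ μ) :
    ContinuousOn (prabhakarKernel ρ μ ω γ) (Ioi 0) := by
  intro t₀ ht₀
  have ht₀ : 0 < t₀ := ht₀
  obtain ⟨N, hN⟩ := exists_nat_ge |γ|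
  obtain ⟨A, hA, hq⟩ := ((Filter.eventually_gt_atTop 0).and
    (eventually_mul_div_rpow_le (2 * |ω|) (2 * t₀) hρ one_half_pos)).exists
  have hC := gammaBound_nonneg hA
  have hpos : ∀ t ∈ Ioo (t₀ / 2) (2 * t₀), 0 < t := fun t ht => by linarith [ht.1]
  have h1 : ContinuousOn (fun t => ∑' j, prabhakarTerm ρ μ ω γ t j) (Ioo (t₀ / 2) (2 * t₀)) := by
    refine continuousOn_tsum (u := fun j : ℕ => gammaBound A * 2 ^ N *
      ((2 * t₀ / A) ^ μ / (t₀ / 2)) * (1 / 2) ^ j) (fun j => ?_)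
      (summable_geometric_two.mul_left _) fun j t ht => ?_
    · refine ContinuousOn.mul continuousOn_const (ContinuousOn.mul ?_ continuousOn_const)
      exact continuousOn_id.rpow_const fun t ht => Or.inl (hpos t ht).ne'
    · have h0 := hpos t ht
      refine (abs_prabhakarTerm_le hρ hμ hN hA h0 j).trans ?_
      gcongr
      · exact ht.2.le
      · exact ht.1.le
      · refine le_trans ?_ hq
        gcongr
        exact ht.2.le
  have h2 : ContinuousOn (prabhakarKernel ρ μ ω γ) (Ioo (t₀ / 2) (2 * t₀)) :=
    h1.congr fun t ht => (hasSum_prabhakarTerm ω γ hρ hμ (hpos t ht)).tsum_eq.symm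
  exact (h2.continuousAt (Ioo_mem_nhds (by linarith) (by linarith))).continuousWithinAt

/-! ### Semigroup property of the kernels -/

theorem intervalIntegrable_conv_of_le_rpow {𝕜 : Type*} [RCLike 𝕜] {f g : ℝ → 𝕜} {M M' a b t : ℝ}
    (ht : 0 < t) (ha : 0 < a) (hb : 0 < b) (hM : 0 ≤ M)
    (hf : ContinuousOn f (Ioi 0)) (hg : ContinuousOn g (Ioi 0))
    (hfM : ∀ s, 0 < s → s ≤ t → ‖f s‖ ≤ M * s ^ (a - 1))
    (hgM : ∀ s, 0 < s → s ≤ t → ‖g s‖ ≤ M' * s ^ (b - 1)) :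
    IntervalIntegrable (fun y => f (t - y) * g y) volume 0 t := by
  have hB := (intervalIntegrable_sub_rpow_mul_rpow ha hb ht).const_mul (M * M')
  rw [intervalIntegrable_iff_integrableOn_Ioo_of_le ht.le] at hB ⊢
  refine Integrable.mono' hB ?_ ?_
  · refine ContinuousOn.aestronglyMeasurable (ContinuousOn.mul ?_ ?_) measurableSet_Ioo
    · exact hf.comp (by fun_prop) fun y hy => sub_pos.2 hy.2
    · exact hg.mono fun y hy => hy.1
  · filter_upwards [ae_restrict_mem measurableSet_Ioo] with y hy
    have h1 := hfM (t - y) (sub_pos.2 hy.2) (by linarith [hy.1])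
    have h2 := hgM y hy.1 hy.2.le
    have hp : 0 ≤ (t - y) ^ (a - 1) := Real.rpow_nonneg (sub_nonneg.2 hy.2.le) _
    rw [norm_mul]
    calc ‖f (t - y)‖ * ‖g y‖ ≤ (M * (t - y) ^ (a - 1)) * (M' * y ^ (b - 1)) := by gcongr
      _ = _ := by ring

theorem intervalIntegrable_prabhakarKernel_mul {ρ μ₁ μ₂ t : ℝ} (ω γ₁ γ₂ : ℝ) (hρ : 0 < ρ)
    (hμ₁ : 0 ≤ μ₁) (hμ₂ : 0 ≤ μ₂) (ht : 0 < t) :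
    IntervalIntegrable
      (fun y => prabhakarKernel ρ μ₁ ω γ₁ (t - y) * prabhakarKernel ρ μ₂ ω γ₂ y) volume 0 t := by
  obtain ⟨M, a, hM, ha, h1⟩ := exists_abs_prabhakarKernel_le ω γ₁ hρ hμ₁ t
  obtain ⟨M', b, -, hb, h2⟩ := exists_abs_prabhakarKernel_le ω γ₂ hρ hμ₂ t
  exact intervalIntegrable_conv_of_le_rpow ht ha hb hM (continuousOn_prabhakarKernel ω γ₁ hρ hμ₁)
    (continuousOn_prabhakarKernel ω γ₂ hρ hμ₂) h1 h2

noncomputable section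

/-- The terms of the double series of the convolution of two Prabhakar kernels. -/
def prabhakarPairTerm (ρ μ₁ μ₂ ω γ₁ γ₂ t : ℝ) (p : ℕ × ℕ) : ℝ :=
  (pochhammerCoeff γ₁ p.1 * ω ^ p.1) * (pochhammerCoeff γ₂ p.2 * ω ^ p.2) *
    rlKernel ((ρ * p.1 + μ₁) + (ρ * p.2 + μ₂)) t

end

theorem summable_abs_prabhakarPairTerm {ρ μ₁ μ₂ t : ℝ} (ω γ₁ γ₂ : ℝ) (hρ : 0 < ρ)
    (hμ₁ : 0 ≤ μ₁) (hμ₂ : 0 ≤ μ₂) (ht : 0 < t) :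
    Summable fun p => |prabhakarPairTerm ρ μ₁ μ₂ ω γ₁ γ₂ t p| := by
  obtain ⟨N, hN⟩ := exists_nat_ge |γ₁|
  obtain ⟨N', hN'⟩ := exists_nat_ge |γ₂|
  obtain ⟨A, hA, hq⟩ := ((Filter.eventually_gt_atTop 0).and
    (eventually_mul_div_rpow_le (2 * |ω|) t hρ one_half_pos)).exists
  have hC := gammaBound_nonneg hA
  have htA : 0 < t / A := div_pos ht hA
  have hgeo : Summable fun j : ℕ => (2 * |ω| * (t / A) ^ ρ) ^ j :=
    summable_geometric_of_lt_one (by positivity) (by linarith)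
  have hgeo2 := (hgeo.mul_of_nonneg hgeo (fun _ => by positivity) (fun _ => by positivity)).mul_left
    (gammaBound A * 2 ^ N * 2 ^ N' * ((t / A) ^ (μ₁ + μ₂) / t))
  refine Summable.of_nonneg_of_le (fun _ => abs_nonneg _) (fun p => ?_) hgeo2
  have hs : 0 ≤ (ρ * p.1 + μ₁) + (ρ * p.2 + μ₂) := by positivity
  rw [prabhakarPairTerm, abs_mul, abs_mul, abs_mul, abs_mul, abs_pow, abs_pow,
    abs_of_nonneg (rlKernel_nonneg hs ht.le)]
  calc |pochhammerCoeff γ₁ p.1| * |ω| ^ p.1 * (|pochhammerCoeff γ₂ p.2| * |ω| ^ p.2) *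
        rlKernel ((ρ * p.1 + μ₁) + (ρ * p.2 + μ₂)) t
      ≤ 2 ^ N * 2 ^ p.1 * |ω| ^ p.1 * (2 ^ N' * 2 ^ p.2 * |ω| ^ p.2) *
        (gammaBound A * ((t / A) ^ ((ρ * p.1 + μ₁) + (ρ * p.2 + μ₂)) / t)) := by
        gcongr
        · exact rlKernel_nonneg hs ht.le
        · exact abs_pochhammerCoeff_le hN _
        · exact abs_pochhammerCoeff_le hN' _
        · exact rlKernel_le hA hs ht
    _ = _ := by
        rw [Real.rpow_add htA, Real.rpow_add htA, Real.rpow_add htA, Real.rpow_add htA,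
          Real.rpow_mul htA.le, Real.rpow_natCast, Real.rpow_mul htA.le, Real.rpow_natCast]
        ring

/-- The order of a pair term depends only on `p.1 + p.2`, so absolute summability allows grouping by
antidiagonals, on which Chu-Vandermonde collapses the coefficients. -/
theorem hasSum_prabhakarPairTerm {ρ μ₁ μ₂ t : ℝ} (ω γ₁ γ₂ : ℝ) (hρ : 0 < ρ)
    (hμ₁ : 0 ≤ μ₁) (hμ₂ : 0 ≤ μ₂) (ht : 0 < t) :
    HasSum (prabhakarPairTerm ρ μ₁ μ₂ ω γ₁ γ₂ t)
      (prabhakarKernel ρ (μ₁ + μ₂) ω (γ₁ + γ₂) t) := by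
  have hZ := (summable_abs_prabhakarPairTerm ω γ₁ γ₂ hρ hμ₁ hμ₂ ht).of_abs.hasSum
  have h1 := ((Finset.HasAntidiagonal.sigmaAntidiagonalEquivProd (A := ℕ)).hasSum_iff.2 hZ).sigma
    fun n => hasSum_fintype _
  have h2 := hasSum_prabhakarTerm ω (γ₁ + γ₂) hρ (add_nonneg hμ₁ hμ₂) ht
  have e : ∀ n, ∑ p : Finset.HasAntidiagonal.antidiagonal n,
      (prabhakarPairTerm ρ μ₁ μ₂ ω γ₁ γ₂ t ∘ Finset.HasAntidiagonal.sigmaAntidiagonalEquivProd) ⟨n, p⟩ =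
      prabhakarTerm ρ (μ₁ + μ₂) ω (γ₁ + γ₂) t n := by
    intro n
    simp only [Function.comp_apply, Finset.HasAntidiagonal.sigmaAntidiagonalEquivProd_apply]
    rw [Finset.sum_coe_sort (Finset.HasAntidiagonal.antidiagonal n)
      (fun p => prabhakarPairTerm ρ μ₁ μ₂ ω γ₁ γ₂ t p), prabhakarTerm,
      ← sum_antidiagonal_pochhammerCoeff, Finset.sum_mul, Finset.sum_mul]
    refine Finset.sum_congr rfl fun p hp => ?_
    have hp' := Finset.HasAntidiagonal.mem_antidiagonal.1 hp
    subst hp'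
    rw [prabhakarPairTerm, pow_add]
    push_cast
    rw [show ρ * (p.1 + p.2 : ℝ) + (μ₁ + μ₂) = (ρ * p.1 + μ₁) + (ρ * p.2 + μ₂) by ring]
    ring
  rw [funext e] at h1
  rw [h2.unique h1]
  exact hZ

/-- The interchange is justified because Riemann-Liouville kernels are nonnegative: the integrals of
the absolute values are themselves beta integrals, bounded by the summable `|prabhakarPairTerm|`. -/
theorem hasSum_integral_prabhakarTerm_mul {ρ μ₁ μ₂ t : ℝ} (ω γ₁ γ₂ : ℝ) (hρ : 0 < ρ)
    (hμ₁ : 0 ≤ μ₁) (hμ₂ : 0 < μ₂) (ht : 0 < t) :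
    HasSum (fun p : ℕ × ℕ => ∫ y in (0 : ℝ)..t,
        prabhakarTerm ρ μ₁ ω γ₁ (t - y) p.1 * prabhakarTerm ρ μ₂ ω γ₂ y p.2)
      (∫ y in (0 : ℝ)..t, prabhakarKernel ρ μ₁ ω γ₁ (t - y) * prabhakarKernel ρ μ₂ ω γ₂ y) := by
  have hs₁ : ∀ p : ℕ × ℕ, 0 ≤ ρ * p.1 + μ₁ := fun p => by positivity
  have hs₂ : ∀ p : ℕ × ℕ, 0 < ρ * p.2 + μ₂ := fun p => by positivity
  have e : ∀ (p : ℕ × ℕ) y, prabhakarTerm ρ μ₁ ω γ₁ (t - y) p.1 * prabhakarTerm ρ μ₂ ω γ₂ y p.2 =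
      (pochhammerCoeff γ₁ p.1 * ω ^ p.1) * (pochhammerCoeff γ₂ p.2 * ω ^ p.2) *
        (rlKernel (ρ * p.1 + μ₁) (t - y) * rlKernel (ρ * p.2 + μ₂) y) := fun p y => by
    simp only [prabhakarTerm]; ring
  have hint : ∀ p : ℕ × ℕ, IntegrableOn (fun y =>
      prabhakarTerm ρ μ₁ ω γ₁ (t - y) p.1 * prabhakarTerm ρ μ₂ ω γ₂ y p.2) (Ioo 0 t) := fun p => by
    simp only [e]
    exact (intervalIntegrable_iff_integrableOn_Ioo_of_le ht.le).1
      ((intervalIntegrable_rlKernel_mul (hs₁ p) (hs₂ p) ht).const_mul _)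
  have hnorm : ∀ p : ℕ × ℕ, ∫ y in Ioo 0 t,
      ‖prabhakarTerm ρ μ₁ ω γ₁ (t - y) p.1 * prabhakarTerm ρ μ₂ ω γ₂ y p.2‖ ≤
      |prabhakarPairTerm ρ μ₁ μ₂ ω γ₁ γ₂ t p| := fun p => by
    have h1 : ∫ y in Ioo 0 t,
        ‖prabhakarTerm ρ μ₁ ω γ₁ (t - y) p.1 * prabhakarTerm ρ μ₂ ω γ₂ y p.2‖ =
        |(pochhammerCoeff γ₁ p.1 * ω ^ p.1) * (pochhammerCoeff γ₂ p.2 * ω ^ p.2)| *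
          ∫ y in (0 : ℝ)..t, rlKernel (ρ * p.1 + μ₁) (t - y) * rlKernel (ρ * p.2 + μ₂) y := by
      rw [intervalIntegral.integral_of_le ht.le, ← integral_Ioc_eq_integral_Ioo,
        ← integral_const_mul]
      refine setIntegral_congr_fun measurableSet_Ioc fun y hy => ?_
      simp only [e]
      rw [norm_mul, Real.norm_eq_abs, Real.norm_of_nonneg]
      exact mul_nonneg (rlKernel_nonneg (hs₁ p) (sub_nonneg.2 hy.2))
        (rlKernel_nonneg (hs₂ p).le hy.1.le)
    rw [h1, prabhakarPairTerm, abs_mul _ (rlKernel _ _)]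
    refine mul_le_mul_of_nonneg_left ?_ (abs_nonneg _)
    -- At order zero the first kernel is identically `0` while the pair term need not vanish, so
    -- only an inequality holds.
    rcases (hs₁ p).eq_or_lt with h0 | h0
    · rw [← h0]
      simp only [rlKernel_zero, zero_mul, intervalIntegral.integral_zero, abs_nonneg]
    · rw [integral_rlKernel_mul h0 (hs₂ p) ht]
      exact le_abs_self _
  have hsum := hasSum_integral_of_summable_integral_norm hint <| by
    refine Summable.of_nonneg_of_le (fun p => ?_) hnorm
      (summable_abs_prabhakarPairTerm ω γ₁ γ₂ hρ hμ₁ hμ₂.le ht)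
    exact integral_nonneg fun y => norm_nonneg _
  simp only [intervalIntegral.integral_of_le ht.le, integral_Ioc_eq_integral_Ioo]
  refine (congrArg (HasSum _ ·) ?_).mp hsum
  refine setIntegral_congr_fun (s := Ioo 0 t) measurableSet_Ioo fun y hy => ?_
  have hty : 0 < t - y := sub_pos.2 hy.2
  have k1 : Summable fun j => ‖prabhakarTerm ρ μ₁ ω γ₁ (t - y) j‖ :=
    summable_abs_prabhakarTerm ω γ₁ hρ hμ₁ hty
  have k2 : Summable fun j => ‖prabhakarTerm ρ μ₂ ω γ₂ y j‖ :=
    summable_abs_prabhakarTerm ω γ₂ hρ hμ₂.le hy.1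
  rw [← (hasSum_prabhakarTerm ω γ₁ hρ hμ₁ hty).tsum_eq,
    ← (hasSum_prabhakarTerm ω γ₂ hρ hμ₂.le hy.1).tsum_eq]
  exact (tsum_mul_tsum_of_summable_norm k1 k2).symm

/-- The semigroup property of the Prabhakar kernels, with a Dirac mass at order zero. -/
theorem prabhakarKernel_conv {ρ μ₁ μ₂ t : ℝ} (ω γ₁ γ₂ : ℝ) (hρ : 0 < ρ)
    (hμ₁ : 0 ≤ μ₁) (hμ₂ : 0 < μ₂) (ht : 0 < t) :
    (if μ₁ = 0 then prabhakarKernel ρ μ₂ ω γ₂ t else 0) +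
      ∫ y in (0 : ℝ)..t, prabhakarKernel ρ μ₁ ω γ₁ (t - y) * prabhakarKernel ρ μ₂ ω γ₂ y =
    prabhakarKernel ρ (μ₁ + μ₂) ω (γ₁ + γ₂) t := by
  have hs₂ : ∀ p : ℕ × ℕ, 0 < ρ * p.2 + μ₂ := fun p => by positivity
  have hI := hasSum_integral_prabhakarTerm_mul ω γ₁ γ₂ hρ hμ₁ hμ₂ ht
  have hZ := hasSum_prabhakarPairTerm ω γ₁ γ₂ hρ hμ₁ hμ₂.le ht
  -- These are exactly the pair terms missing from the integrals: if `μ₁ = 0`, the row `p.1 = 0`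
  -- integrates to `0`, and the Dirac mass restores it.
  have hD : HasSum (fun p : ℕ × ℕ => if μ₁ = 0 ∧ p.1 = 0 then
      prabhakarPairTerm ρ μ₁ μ₂ ω γ₁ γ₂ t p else 0)
      (if μ₁ = 0 then prabhakarKernel ρ μ₂ ω γ₂ t else 0) := by
    by_cases h0 : μ₁ = 0
    · subst h0
      simp only [true_and, if_true]
      have hinj : Function.Injective (fun j : ℕ => ((0 : ℕ), j)) := fun i j h => by simpa using h
      rw [← hinj.hasSum_iff]
      · convert hasSum_prabhakarTerm ω γ₂ hρ hμ₂.le ht using 1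
        funext j
        simp [prabhakarPairTerm, prabhakarTerm, pochhammerCoeff]
      · rintro ⟨i, j⟩ hp
        refine if_neg fun hi => hp ⟨j, ?_⟩
        simp only at hi
        rw [hi]
    · simp [h0]
  refine (hD.add hI).unique ?_
  convert hZ using 1
  funext p
  have e : ∀ y, prabhakarTerm ρ μ₁ ω γ₁ (t - y) p.1 * prabhakarTerm ρ μ₂ ω γ₂ y p.2 =
      (pochhammerCoeff γ₁ p.1 * ω ^ p.1) * (pochhammerCoeff γ₂ p.2 * ω ^ p.2) *
        (rlKernel (ρ * p.1 + μ₁) (t - y) * rlKernel (ρ * p.2 + μ₂) y) := fun y => by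
    simp only [prabhakarTerm]; ring
  simp only [e]
  rw [intervalIntegral.integral_const_mul]
  by_cases h0 : μ₁ = 0 ∧ p.1 = 0
  · rw [if_pos h0, h0.1, h0.2]
    simp [rlKernel_zero]
  · have hpos : 0 < ρ * p.1 + μ₁ := by
      rcases hμ₁.eq_or_lt with h | h
      · have : 0 < p.1 := Nat.pos_of_ne_zero fun h' => h0 ⟨h.symm, h'⟩
        have : (0 : ℝ) < p.1 := by exact_mod_cast this
        positivity
      · positivity
    rw [if_neg h0, zero_add, integral_rlKernel_mul hpos (hs₂ p) ht, prabhakarPairTerm]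

/-- Since `(0)ₖ = 0` for `k ≥ 1`, order one with parameter zero is ordinary integration. -/
theorem prabhakarKernel_one_zero {t : ℝ} (ρ ω : ℝ) : prabhakarKernel ρ 1 ω 0 t = 1 := by
  have h : ∀ k : ℕ, k ≠ 0 → (ascPochhammer ℝ k).eval 0 * (Real.Gamma (ρ * k + 1))⁻¹ *
      (ω * t ^ ρ) ^ k / (k.factorial : ℝ) = 0 := fun k hk => by
    rw [ascPochhammer_eval_zero, if_neg hk]; simp
  rw [prabhakarKernel, mittagLeffler, tsum_eq_single 0 h]
  simp

/-! ### Series of Prabhakar kernels -/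

noncomputable section

/-- The series `∑ₙ cⁿ t^{β+nμ-1} E_{ρ,β+nμ}^{x+nγ}(ω t^ρ)`. -/
def prabhakarSeries (ρ ω γ μ : ℝ) (c : ℂ) (β x t : ℝ) : ℂ :=
  ∑' n : ℕ, c ^ n * (prabhakarKernel ρ (β + n * μ) ω (x + n * γ) t : ℂ)

end

section Series

variable {ρ μ β : ℝ}

/-- The growing parameter `x + nγ` costs `2^(nK)`; together with `‖c‖ⁿ` it is absorbed by the factor
`(t/A)^(nμ)` of the growing order. -/
theorem exists_norm_prabhakarSeries_term_le (ω γ : ℝ) (c : ℂ) (x : ℝ) (hρ : 0 < ρ) (hμ : 0 < μ)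
    (hβ : 0 < β) (T : ℝ) :
    ∃ M : ℝ, 0 ≤ M ∧ ∀ (n : ℕ) (t : ℝ), 0 < t → t ≤ T →
      ‖c ^ n * (prabhakarKernel ρ (β + n * μ) ω (x + n * γ) t : ℂ)‖ ≤
        M * t ^ (β - 1) * (1 / 2) ^ n := by
  obtain ⟨N, hN⟩ := exists_nat_ge |x|
  obtain ⟨K, hK⟩ := exists_nat_ge |γ|
  -- One `A`, independent of `n`, controls both the inner series in `j` (`hq`) and the outer series
  -- in `n` (`hr`).
  obtain ⟨A, hA, hq, hr⟩ := ((Filter.eventually_gt_atTop 0).and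
    ((eventually_mul_div_rpow_le (2 * |ω|) T hρ one_half_pos).and
    (eventually_mul_div_rpow_le (‖c‖ * 2 ^ K) T hμ one_half_pos))).exists
  have hC := gammaBound_nonneg hA
  refine ⟨2 * gammaBound A * 2 ^ N * (A ^ β)⁻¹, by positivity, fun n t ht htT => ?_⟩
  have htA : 0 < t / A := div_pos ht hA
  have hx : |x + n * γ| ≤ (N + n * K : ℕ) := by
    push_cast
    refine (abs_add_le _ _).trans ?_
    rw [abs_mul, Nat.abs_cast]
    gcongr
  have hk := abs_prabhakarKernel_le hρ (by positivity : 0 ≤ β + n * μ) hx hA ht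
    (le_trans (by gcongr) hq)
  have hr' : ‖c‖ * 2 ^ K * (t / A) ^ μ ≤ 1 / 2 := le_trans (by gcongr) hr
  rw [norm_mul, norm_pow, Complex.norm_real, Real.norm_eq_abs]
  calc ‖c‖ ^ n * |prabhakarKernel ρ (β + n * μ) ω (x + n * γ) t|
      ≤ ‖c‖ ^ n * (2 * gammaBound A * 2 ^ (N + n * K) * ((t / A) ^ (β + n * μ) / t)) := by gcongr
    _ = 2 * gammaBound A * 2 ^ N * ((t / A) ^ β / t) * (‖c‖ * 2 ^ K * (t / A) ^ μ) ^ n := by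
        rw [Real.rpow_add htA, mul_comm (n : ℝ) μ, Real.rpow_mul htA.le, Real.rpow_natCast,
          pow_add, mul_comm n K, pow_mul, mul_pow, mul_pow]
        ring
    _ ≤ 2 * gammaBound A * 2 ^ N * ((t / A) ^ β / t) * (1 / 2) ^ n := by gcongr
    _ = _ := by
        rw [Real.rpow_sub_one ht.ne', Real.div_rpow ht.le hA.le]
        ring

theorem hasSum_prabhakarSeries (ω γ : ℝ) (c : ℂ) (x : ℝ) (hρ : 0 < ρ) (hμ : 0 < μ)
    (hβ : 0 < β) {t : ℝ} (ht : 0 < t) :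
    HasSum (fun n : ℕ => c ^ n * (prabhakarKernel ρ (β + n * μ) ω (x + n * γ) t : ℂ))
      (prabhakarSeries ρ ω γ μ c β x t) := by
  obtain ⟨M, -, h⟩ := exists_norm_prabhakarSeries_term_le ω γ c x hρ hμ hβ t
  exact (Summable.of_norm_bounded (summable_geometric_two.mul_left _)
    fun n => h n t ht le_rfl).hasSum

theorem exists_norm_prabhakarSeries_le (ω γ : ℝ) (c : ℂ) (x : ℝ) (hρ : 0 < ρ) (hμ : 0 < μ)
    (hβ : 0 < β) (T : ℝ) :
    ∃ M : ℝ, 0 ≤ M ∧ ∀ t : ℝ, 0 < t → t ≤ T →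
      ‖prabhakarSeries ρ ω γ μ c β x t‖ ≤ M * t ^ (β - 1) := by
  obtain ⟨M, hM, h⟩ := exists_norm_prabhakarSeries_term_le ω γ c x hρ hμ hβ T
  refine ⟨M * 2, by positivity, fun t ht htT => ?_⟩
  refine (tsum_of_norm_bounded (hasSum_geometric_two.mul_left (M * t ^ (β - 1)))
    fun n => h n t ht htT).trans (le_of_eq (by ring))

theorem continuousOn_prabhakarSeries (ω γ : ℝ) (c : ℂ) (x : ℝ) (hρ : 0 < ρ) (hμ : 0 < μ)
    (hβ : 0 < β) : ContinuousOn (prabhakarSeries ρ ω γ μ c β x) (Ioi 0) := by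
  intro t₀ ht₀
  have ht₀ : 0 < t₀ := ht₀
  obtain ⟨M, hM, h⟩ := exists_norm_prabhakarSeries_term_le ω γ c x hρ hμ hβ (2 * t₀)
  have hpos : ∀ t ∈ Ioo (t₀ / 2) (2 * t₀), 0 < t := fun t ht => by linarith [ht.1]
  have hc : ContinuousOn (fun t : ℝ => t ^ (β - 1)) (Icc (t₀ / 2) (2 * t₀)) :=
    continuousOn_id.rpow_const fun t ht => Or.inl (by
      have := ht.1
      simp only [id]
      linarith)
  obtain ⟨B, hB⟩ := isCompact_Icc.exists_bound_of_continuousOn hc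
  have h2 : ContinuousOn (prabhakarSeries ρ ω γ μ c β x) (Ioo (t₀ / 2) (2 * t₀)) := by
    refine continuousOn_tsum (u := fun n : ℕ => M * B * (1 / 2) ^ n) (fun n => ?_)
      (summable_geometric_two.mul_left _) fun n t ht => ?_
    · refine continuousOn_const.mul (Complex.continuous_ofReal.comp_continuousOn ?_)
      exact (continuousOn_prabhakarKernel ω _ hρ (by positivity)).mono fun t ht => hpos t ht
    · refine (h n t (hpos t ht) ht.2.le).trans ?_
      have := (Real.le_norm_self _).trans (hB t (Ioo_subset_Icc_self ht))
      gcongr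
  exact (h2.continuousAt (Ioo_mem_nhds (by linarith) (by linarith))).continuousWithinAt

theorem prabhakarConverges_prabhakarSeries {μ₁ t : ℝ} (ω γ γ₁ : ℝ) (c : ℂ) (x : ℝ) (hρ : 0 < ρ)
    (hμ : 0 < μ) (hβ : 0 < β) (hμ₁ : 0 ≤ μ₁) (ht : 0 < t) :
    PrabhakarConverges ρ μ₁ ω γ₁ (prabhakarSeries ρ ω γ μ c β x) t := by
  obtain ⟨M, a, hM, ha, h1⟩ := exists_abs_prabhakarKernel_le ω γ₁ hρ hμ₁ t
  obtain ⟨M', -, h2⟩ := exists_norm_prabhakarSeries_le ω γ c x hρ hμ hβ t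
  refine intervalIntegrable_conv_of_le_rpow (f := fun s => (prabhakarKernel ρ μ₁ ω γ₁ s : ℂ))
    ht ha hβ hM ?_ (continuousOn_prabhakarSeries ω γ c x hρ hμ hβ) (fun s hs hst => ?_) h2
  · exact Complex.continuous_ofReal.comp_continuousOn (continuousOn_prabhakarKernel ω γ₁ hρ hμ₁)
  · rw [Complex.norm_real]
    exact h1 s hs hst

/-- The semigroup property applied termwise; dominated convergence holds with a beta integrand times
`2⁻ⁿ`. -/
theorem prabhakarIntegral_prabhakarSeries {μ₁ t : ℝ} (ω γ γ₁ : ℝ) (c : ℂ) (x : ℝ) (hρ : 0 < ρ)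
    (hμ : 0 < μ) (hβ : 0 < β) (hμ₁ : 0 ≤ μ₁) (ht : 0 < t) :
    prabhakarIntegral ρ μ₁ ω γ₁ (prabhakarSeries ρ ω γ μ c β x) t =
      prabhakarSeries ρ ω γ μ c (μ₁ + β) (γ₁ + x) t := by
  obtain ⟨M, a, hM, ha, h1⟩ := exists_abs_prabhakarKernel_le ω γ₁ hρ hμ₁ t
  obtain ⟨M', hM', h2⟩ := exists_norm_prabhakarSeries_term_le ω γ c x hρ hμ hβ t
  have hI : HasSum (fun n : ℕ => ∫ y in (0 : ℝ)..t, (prabhakarKernel ρ μ₁ ω γ₁ (t - y) : ℂ) *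
      (c ^ n * (prabhakarKernel ρ (β + n * μ) ω (x + n * γ) y : ℂ)))
      (∫ y in (0 : ℝ)..t, (prabhakarKernel ρ μ₁ ω γ₁ (t - y) : ℂ) *
        prabhakarSeries ρ ω γ μ c β x y) := by
    simp only [intervalIntegral.integral_of_le ht.le, integral_Ioc_eq_integral_Ioo]
    refine hasSum_integral_of_dominated_convergence
      (fun n y => M * M' * ((t - y) ^ (a - 1) * y ^ (β - 1)) * (1 / 2) ^ n) (fun n => ?_)
      (fun n => ?_) ?_ ?_ ?_
    · refine ContinuousOn.aestronglyMeasurable (ContinuousOn.mul ?_ (continuousOn_const.mul ?_))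
        measurableSet_Ioo
      · refine Complex.continuous_ofReal.comp_continuousOn ?_
        exact (continuousOn_prabhakarKernel ω γ₁ hρ hμ₁).comp (by fun_prop)
          fun y hy => sub_pos.2 hy.2
      · refine Complex.continuous_ofReal.comp_continuousOn ?_
        exact (continuousOn_prabhakarKernel ω _ hρ (by positivity)).mono fun y hy => hy.1
    · filter_upwards [ae_restrict_mem measurableSet_Ioo] with y hy
      have e1 := h1 (t - y) (sub_pos.2 hy.2) (by linarith [hy.1])
      have e2 := h2 n y hy.1 hy.2.le
      have hp : 0 ≤ (t - y) ^ (a - 1) := Real.rpow_nonneg (sub_nonneg.2 hy.2.le) _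
      rw [norm_mul, Complex.norm_real, Real.norm_eq_abs]
      refine (mul_le_mul e1 e2 (norm_nonneg _) (by positivity)).trans (le_of_eq (by ring))
    · exact Filter.Eventually.of_forall fun y => summable_geometric_two.mul_left _
    · simp only [tsum_mul_left]
      refine Integrable.mul_const (Integrable.const_mul ?_ _) _
      exact (intervalIntegrable_iff_integrableOn_Ioo_of_le ht.le).1
        (intervalIntegrable_sub_rpow_mul_rpow ha hβ ht)
    · filter_upwards [ae_restrict_mem measurableSet_Ioo] with y hy
      exact (hasSum_prabhakarSeries ω γ c x hρ hμ hβ hy.1).mul_left _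
  have hD : HasSum (fun n : ℕ => if μ₁ = 0 then
      c ^ n * (prabhakarKernel ρ (β + n * μ) ω (x + n * γ) t : ℂ) else 0)
      (if μ₁ = 0 then prabhakarSeries ρ ω γ μ c β x t else 0) := by
    split_ifs
    · exact hasSum_prabhakarSeries ω γ c x hρ hμ hβ ht
    · exact hasSum_zero
  have hR := hasSum_prabhakarSeries ω γ c (γ₁ + x) hρ hμ (add_pos_of_nonneg_of_pos hμ₁ hβ) ht
  rw [prabhakarIntegral]
  refine (hD.add hI).unique ?_
  convert hR using 1
  funext n
  have hconv := prabhakarKernel_conv ω γ₁ (x + n * γ) hρ hμ₁ (by positivity : 0 < β + n * μ) ht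
  rw [add_assoc μ₁, add_assoc γ₁, ← hconv]
  have e : ∀ y, (prabhakarKernel ρ μ₁ ω γ₁ (t - y) : ℂ) *
      (c ^ n * (prabhakarKernel ρ (β + n * μ) ω (x + n * γ) y : ℂ)) =
      c ^ n * ((prabhakarKernel ρ μ₁ ω γ₁ (t - y) *
        prabhakarKernel ρ (β + n * μ) ω (x + n * γ) y : ℝ) : ℂ) := fun y => by
    push_cast; ring
  simp only [e]
  rw [intervalIntegral.integral_const_mul, intervalIntegral.integral_ofReal, Complex.ofReal_add,
    mul_add]
  split_ifs <;> simp

theorem prabhakarSeries_succ (ω γ : ℝ) (c : ℂ) (x : ℝ) (hρ : 0 < ρ) (hμ : 0 < μ)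
    (hβ : 0 < β) {t : ℝ} (ht : 0 < t) :
    prabhakarSeries ρ ω γ μ c β x t =
      prabhakarKernel ρ β ω x t + c * prabhakarSeries ρ ω γ μ c (β + μ) (x + γ) t := by
  rw [prabhakarSeries, (hasSum_prabhakarSeries ω γ c x hρ hμ hβ ht).summable.tsum_eq_zero_add,
    prabhakarSeries, ← tsum_mul_left]
  congr 1
  · simp
  · refine tsum_congr fun n => ?_
    rw [show β + ((n + 1 : ℕ) : ℝ) * μ = β + μ + n * μ by push_cast; ring,
      show x + ((n + 1 : ℕ) : ℝ) * γ = x + γ + n * γ by push_cast; ring]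
    ring

end Series

/-! ### Congruence and linearity of Prabhakar integrals -/

theorem PrabhakarConverges.congr {ρ μ ω γ t : ℝ} {f g : ℝ → ℂ}
    (hf : PrabhakarConverges ρ μ ω γ f t) (ht : 0 < t) (h : EqOn f g (Ioc 0 t)) :
    PrabhakarConverges ρ μ ω γ g t := by
  refine IntervalIntegrable.congr (fun y hy => ?_) hf
  rw [uIoc_of_le ht.le] at hy
  simp only [h hy]

theorem prabhakarIntegral_congr {ρ μ ω γ t : ℝ} {f g : ℝ → ℂ} (ht : 0 < t)
    (h : EqOn f g (Ioc 0 t)) : prabhakarIntegral ρ μ ω γ f t = prabhakarIntegral ρ μ ω γ g t := by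
  rw [prabhakarIntegral, prabhakarIntegral, h ⟨ht, le_rfl⟩]
  congr 1
  refine intervalIntegral.integral_congr_Ioo_of_le ht.le fun y hy => ?_
  simp only [h ⟨hy.1, hy.2.le⟩]

theorem PrabhakarConverges.const_mul {ρ μ ω γ t : ℝ} {f : ℝ → ℂ}
    (hf : PrabhakarConverges ρ μ ω γ f t) (c : ℂ) :
    PrabhakarConverges ρ μ ω γ (fun y => c * f y) t :=
  (IntervalIntegrable.const_mul hf c).congr fun y _ => by simp only; ring

theorem prabhakarIntegral_const_mul (ρ μ ω γ t : ℝ) (f : ℝ → ℂ) (c : ℂ) :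
    prabhakarIntegral ρ μ ω γ (fun y => c * f y) t = c * prabhakarIntegral ρ μ ω γ f t := by
  rw [prabhakarIntegral, prabhakarIntegral, mul_add, ← intervalIntegral.integral_const_mul]
  congr 1
  · split_ifs <;> simp
  · congr 1
    funext y
    ring

theorem prabhakarIntegral_one_zero (ρ ω t : ℝ) (f : ℝ → ℂ) :
    prabhakarIntegral ρ 1 ω 0 f t = ∫ y in (0 : ℝ)..t, f y := by
  simp [prabhakarIntegral, prabhakarKernel_one_zero]

theorem prabhakarConverges_one_zero {ρ ω t : ℝ} {f : ℝ → ℂ} :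
    PrabhakarConverges ρ 1 ω 0 f t ↔ IntervalIntegrable f volume 0 t := by
  simp [PrabhakarConverges, prabhakarKernel_one_zero]

/-! ### Complex-valued absolutely continuous functions -/

/-- Passes absolute continuity between a complex function and its real and imaginary parts, in both
directions. -/
theorem AbsolutelyContinuousOnInterval.of_dist_le_add {X Y Z : Type*} [PseudoMetricSpace X]
    [PseudoMetricSpace Y] [PseudoMetricSpace Z] {f : ℝ → X} {g : ℝ → Y} {h : ℝ → Z} {a b : ℝ}
    (hg : AbsolutelyContinuousOnInterval g a b) (hh : AbsolutelyContinuousOnInterval h a b)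
    (hle : ∀ x ∈ uIcc a b, ∀ y ∈ uIcc a b, dist (f x) (f y) ≤ dist (g x) (g y) + dist (h x) (h y)) :
    AbsolutelyContinuousOnInterval f a b := by
  rw [absolutelyContinuousOnInterval_iff] at hg hh ⊢
  intro ε hε
  obtain ⟨δ, hδ, h1⟩ := hg (ε / 2) (half_pos hε)
  obtain ⟨δ', hδ', h2⟩ := hh (ε / 2) (half_pos hε)
  refine ⟨min δ δ', lt_min hδ hδ', fun E hE hlt => ?_⟩
  have e1 := h1 E hE (hlt.trans_le (min_le_left _ _))
  have e2 := h2 E hE (hlt.trans_le (min_le_right _ _))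
  refine lt_of_le_of_lt (Finset.sum_le_sum fun i hi => hle _ (hE.1 i hi).1 _ (hE.1 i hi).2) ?_
  rw [Finset.sum_add_distrib]
  linarith

theorem Complex.dist_le_dist_re_add_dist_im (z w : ℂ) :
    dist z w ≤ dist z.re w.re + dist z.im w.im := by
  rw [Complex.dist_eq, Real.dist_eq, Real.dist_eq]
  exact Complex.norm_le_abs_re_add_abs_im (z - w)

theorem IntervalIntegrable.absolutelyContinuousOnInterval_integral_complex {f : ℝ → ℂ} {a b : ℝ}
    (hf : IntervalIntegrable f volume a b) :
    AbsolutelyContinuousOnInterval (fun x => ∫ y in a..x, f y) a b := by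
  have hre : IntervalIntegrable (fun y => (f y).re) volume a b := ⟨hf.1.re, hf.2.re⟩
  have him : IntervalIntegrable (fun y => (f y).im) volume a b := ⟨hf.1.im, hf.2.im⟩
  have e1 : ∀ x ∈ uIcc a b, (∫ y in a..x, f y).re = ∫ y in a..x, (f y).re := fun x hx =>
    (Complex.reCLM.intervalIntegral_comp_comm
      (hf.mono_set (uIcc_subset_uIcc left_mem_uIcc hx))).symm
  have e2 : ∀ x ∈ uIcc a b, (∫ y in a..x, f y).im = ∫ y in a..x, (f y).im := fun x hx =>
    (Complex.imCLM.intervalIntegral_comp_comm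
      (hf.mono_set (uIcc_subset_uIcc left_mem_uIcc hx))).symm
  refine (hre.absolutelyContinuousOnInterval_intervalIntegral left_mem_uIcc).of_dist_le_add
    (him.absolutelyContinuousOnInterval_intervalIntegral left_mem_uIcc) fun x hx y hy => ?_
  refine (Complex.dist_le_dist_re_add_dist_im _ _).trans ?_
  rw [e1 x hx, e1 y hy, e2 x hx, e2 y hy]

theorem IntervalIntegrable.complex_ofReal {f : ℝ → ℝ} {a b : ℝ}
    (hf : IntervalIntegrable f volume a b) :
    IntervalIntegrable (fun x => (f x : ℂ)) volume a b :=
  ⟨hf.1.ofReal, hf.2.ofReal⟩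

theorem AbsolutelyContinuousOnInterval.re_im_complex {f : ℝ → ℂ} {a b : ℝ}
    (hf : AbsolutelyContinuousOnInterval f a b) :
    AbsolutelyContinuousOnInterval (fun x => (f x).re) a b ∧
    AbsolutelyContinuousOnInterval (fun x => (f x).im) a b ∧
    ∀ᵐ x : ℝ, x ∈ uIcc a b → deriv f x =
      ((deriv (fun y => (f y).re) x : ℝ) : ℂ) + ((deriv (fun y => (f y).im) x : ℝ) : ℂ) * Complex.I := by
  have hre : AbsolutelyContinuousOnInterval (fun x => (f x).re) a b :=
    hf.of_dist_le_add hf fun x _ y _ => by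
      have : dist (f x).re (f y).re ≤ dist (f x) (f y) := by
        rw [Complex.dist_eq, Real.dist_eq]; exact Complex.abs_re_le_norm (f x - f y)
      linarith [dist_nonneg (x := f x) (y := f y)]
  have him : AbsolutelyContinuousOnInterval (fun x => (f x).im) a b :=
    hf.of_dist_le_add hf fun x _ y _ => by
      have : dist (f x).im (f y).im ≤ dist (f x) (f y) := by
        rw [Complex.dist_eq, Real.dist_eq]; exact Complex.abs_im_le_norm (f x - f y)
      linarith [dist_nonneg (x := f x) (y := f y)]
  refine ⟨hre, him, ?_⟩
  filter_upwards [hre.ae_differentiableAt, him.ae_differentiableAt] with x h1 h2 hx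
  have h := ((h1 hx).hasDerivAt.ofReal_comp).add
    (((h2 hx).hasDerivAt.ofReal_comp).mul_const Complex.I)
  refine HasDerivAt.deriv (h.congr_of_eventuallyEq (Filter.Eventually.of_forall fun y => ?_))
  exact (Complex.re_add_im (f y)).symm

theorem AbsolutelyContinuousOnInterval.intervalIntegrable_deriv_complex {f : ℝ → ℂ} {a b : ℝ}
    (hf : AbsolutelyContinuousOnInterval f a b) :
    IntervalIntegrable (deriv f) volume a b := by
  obtain ⟨hre, him, hd⟩ := hf.re_im_complex
  have h : IntervalIntegrable (fun x => ((deriv (fun y => (f y).re) x : ℝ) : ℂ) +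
      ((deriv (fun y => (f y).im) x : ℝ) : ℂ) * Complex.I) volume a b :=
    hre.intervalIntegrable_deriv.complex_ofReal.add (him.intervalIntegrable_deriv.complex_ofReal.mul_const _)
  refine h.congr_ae ?_
  rw [Filter.EventuallyEq, ae_restrict_iff' measurableSet_uIoc]
  filter_upwards [hd] with x hx hx'
  exact (hx (uIoc_subset_uIcc hx')).symm

theorem AbsolutelyContinuousOnInterval.integral_deriv_eq_sub_complex {f : ℝ → ℂ} {a b : ℝ}
    (hf : AbsolutelyContinuousOnInterval f a b) :
    ∫ x in a..b, deriv f x = f b - f a := by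
  obtain ⟨hre, him, hd⟩ := hf.re_im_complex
  have h1 := hre.integral_deriv_eq_sub
  have h2 := him.integral_deriv_eq_sub
  rw [intervalIntegral.integral_congr_ae
    (hd.mono fun x hx hx' => hx (uIoc_subset_uIcc hx')),
    intervalIntegral.integral_add hre.intervalIntegrable_deriv.complex_ofReal
      (him.intervalIntegrable_deriv.complex_ofReal.mul_const _), intervalIntegral.integral_mul_const,
    intervalIntegral.integral_ofReal, intervalIntegral.integral_ofReal, h1, h2]
  apply Complex.ext <;> simp

/-! ### The series solves the Cauchy problem -/

section Solution

variable {ρ ω γ μ lam : ℝ} {v : ℂ}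

theorem solutionTerm_eq (t : ℝ) (n : ℕ) :
    solutionTerm ρ ω γ μ lam v t n =
      (-(lam : ℂ) * (1 - v)) ^ n *
        (prabhakarKernel ρ (1 + n * μ) (-ω) (0 + n * γ) t : ℂ) := by
  rw [solutionTerm, mul_pow, prabhakarKernel, zero_add, add_comm 1, add_sub_cancel_right]

theorem solutionSeries_eq : solutionSeries ρ ω γ μ lam v =
    prabhakarSeries ρ (-ω) γ μ (-(lam : ℂ) * (1 - v)) 1 0 := by
  funext t
  exact tsum_congr fun n => solutionTerm_eq t n

theorem solutionTerm_zero_eq_zero (hμ : 0 < μ) {n : ℕ} (hn : n ≠ 0) :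
    solutionTerm ρ ω γ μ lam v 0 n = 0 := by
  have : (0 : ℝ) < n := by exact_mod_cast Nat.pos_of_ne_zero hn
  rw [solutionTerm, Real.zero_rpow (by positivity)]
  simp

theorem summable_solutionTerm (hρ : 0 < ρ) (hμ : 0 < μ) {t : ℝ} (ht : 0 ≤ t) :
    Summable (solutionTerm ρ ω γ μ lam v t) := by
  rcases ht.eq_or_lt with rfl | ht
  · exact summable_of_ne_finset_zero (s := {0}) fun n hn =>
      solutionTerm_zero_eq_zero hμ (by simpa using hn)
  · exact (hasSum_prabhakarSeries (-ω) γ (-(lam : ℂ) * (1 - v)) 0 hρ hμ one_pos ht).summable.congr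
      fun n => (solutionTerm_eq t n).symm

theorem solutionSeries_zero (hμ : 0 < μ) : solutionSeries ρ ω γ μ lam v 0 = 1 := by
  rw [solutionSeries, tsum_eq_single 0 fun n hn => solutionTerm_zero_eq_zero hμ hn,
    solutionTerm_eq]
  -- The surviving term `n = 0` has value `1` at `t = 0` because `0 ^ 0 = 1`.
  simp [prabhakarKernel_one_zero]

theorem intervalIntegrable_prabhakarSeries (hρ : 0 < ρ) (hμ : 0 < μ) (c : ℂ) {t : ℝ} (ht : 0 < t) :
    IntervalIntegrable (prabhakarSeries ρ ω γ μ c μ γ) volume 0 t :=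
  prabhakarConverges_one_zero.1
    (prabhakarConverges_prabhakarSeries ω γ 0 c γ hρ hμ hμ zero_le_one ht)

/-- Integration is the operator of order `1` and parameter `0`, so it raises the order `μ` to `1 +
μ` and gives the tail of `G`. Absolute continuity and the derivative both follow, without
differentiating termwise. -/
theorem solutionSeries_eq_integral (hρ : 0 < ρ) (hμ : 0 < μ) {t : ℝ} (ht : 0 ≤ t) :
    solutionSeries ρ ω γ μ lam v t = 1 + ∫ s in (0 : ℝ)..t, -(lam : ℂ) * (1 - v) *
      prabhakarSeries ρ (-ω) γ μ (-(lam : ℂ) * (1 - v)) μ γ s := by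
  rcases ht.eq_or_lt with rfl | ht
  · simp [solutionSeries_zero hμ]
  · rw [solutionSeries_eq, prabhakarSeries_succ (-ω) γ _ 0 hρ hμ one_pos ht,
      prabhakarKernel_one_zero, Complex.ofReal_one, intervalIntegral.integral_const_mul,
      ← prabhakarIntegral_one_zero ρ (-ω),
      prabhakarIntegral_prabhakarSeries (-ω) γ 0 _ γ hρ hμ hμ zero_le_one ht]

theorem absolutelyContinuousOnInterval_solutionSeries (hρ : 0 < ρ) (hμ : 0 < μ) {b : ℝ}
    (hb : 0 < b) : AbsolutelyContinuousOnInterval (solutionSeries ρ ω γ μ lam v) 0 b := by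
  have h := ((intervalIntegrable_prabhakarSeries (ω := -ω) (γ := γ) hρ hμ
    (-(lam : ℂ) * (1 - v)) hb).const_mul
    (-(lam : ℂ) * (1 - v))).absolutelyContinuousOnInterval_integral_complex
  refine h.of_dist_le_add h fun x hx y hy => ?_
  rw [uIcc_of_le hb.le] at hx hy
  rw [solutionSeries_eq_integral hρ hμ hx.1, solutionSeries_eq_integral hρ hμ hy.1, dist_add_left]
  exact le_add_of_nonneg_right dist_nonneg

theorem hasDerivAt_solutionSeries (hρ : 0 < ρ) (hμ : 0 < μ) {t : ℝ} (ht : 0 < t) :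
    HasDerivAt (solutionSeries ρ ω γ μ lam v) (-(lam : ℂ) * (1 - v) *
      prabhakarSeries ρ (-ω) γ μ (-(lam : ℂ) * (1 - v)) μ γ t) t := by
  set c : ℂ := -(lam : ℂ) * (1 - v) with hc
  have hcont : ContinuousOn (fun s => c * prabhakarSeries ρ (-ω) γ μ c μ γ s) (Ioi 0) :=
    continuousOn_const.mul (continuousOn_prabhakarSeries (-ω) γ c γ hρ hμ hμ)
  have hd := intervalIntegral.integral_hasDerivAt_right
    ((intervalIntegrable_prabhakarSeries (ω := -ω) (γ := γ) hρ hμ c ht).const_mul c)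
    (hcont.stronglyMeasurableAtFilter isOpen_Ioi t ht) (hcont.continuousAt (Ioi_mem_nhds ht))
  refine (hd.const_add 1).congr_of_eventuallyEq ?_
  filter_upwards [Ioi_mem_nhds ht] with s hs
  exact solutionSeries_eq_integral hρ hμ (le_of_lt hs)

theorem eqOn_prabhakarIntegral_deriv_solutionSeries {μ₂ γ₂ : ℝ} (hρ : 0 < ρ) (hμ : 0 < μ)
    (hμ₂ : 0 ≤ μ₂) :
    EqOn (prabhakarIntegral ρ μ₂ (-ω) γ₂ (deriv (solutionSeries ρ ω γ μ lam v)))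
      (fun s => -(lam : ℂ) * (1 - v) *
        prabhakarSeries ρ (-ω) γ μ (-(lam : ℂ) * (1 - v)) (μ₂ + μ) (γ₂ + γ) s) (Ioi 0) := by
  intro t ht
  rw [prabhakarIntegral_congr ht fun s hs => (hasDerivAt_solutionSeries hρ hμ hs.1).deriv,
    prabhakarIntegral_const_mul, prabhakarIntegral_prabhakarSeries _ _ _ _ _ hρ hμ hμ hμ₂ ht]

theorem regularizedHilferPrabhakarExists_solutionSeries {ν : ℝ} (hρ : 0 < ρ) (hμ : 0 < μ)
    (hμ1 : μ ≤ 1) (hν : 0 ≤ ν) (hν1 : ν ≤ 1) :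
    RegularizedHilferPrabhakarExists ρ (-ω) γ μ ν (solutionSeries ρ ω γ μ lam v) := by
  intro t ht
  have h1 : 0 ≤ ν * (1 - μ) := mul_nonneg hν (sub_nonneg.2 hμ1)
  have h2 : 0 ≤ (1 - ν) * (1 - μ) := mul_nonneg (sub_nonneg.2 hν1) (sub_nonneg.2 hμ1)
  refine ⟨(hasDerivAt_solutionSeries hρ hμ ht).differentiableAt, ?_, ?_⟩
  · exact ((prabhakarConverges_prabhakarSeries (-ω) γ _ _ γ hρ hμ hμ h2 ht).const_mul _).congr ht
      fun s hs => (hasDerivAt_solutionSeries hρ hμ hs.1).deriv.symm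
  · exact ((prabhakarConverges_prabhakarSeries (-ω) γ _ _ _ hρ hμ
      (add_pos_of_nonneg_of_pos h2 hμ) h1 ht).const_mul _).congr ht
      fun s hs => (eqOn_prabhakarIntegral_deriv_solutionSeries hρ hμ h2 hs.1).symm

/-- The orders `μ`, `(1-ν)(1-μ)`, `ν(1-μ)` add up to `1` and the parameters `γ`, `-γ(1-ν)`, `-γν` to
`0`, whatever `ν` is. -/
theorem regularizedHilferPrabhakar_solutionSeries {ν : ℝ} (hρ : 0 < ρ) (hμ : 0 < μ)
    (hμ1 : μ ≤ 1) (hν : 0 ≤ ν) (hν1 : ν ≤ 1) {t : ℝ} (ht : 0 < t) :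
    regularizedHilferPrabhakar ρ (-ω) γ μ ν (solutionSeries ρ ω γ μ lam v) t =
      -(lam : ℂ) * (1 - v) * solutionSeries ρ ω γ μ lam v t := by
  have h1 : 0 ≤ ν * (1 - μ) := mul_nonneg hν (sub_nonneg.2 hμ1)
  have h2 : 0 ≤ (1 - ν) * (1 - μ) := mul_nonneg (sub_nonneg.2 hν1) (sub_nonneg.2 hμ1)
  rw [regularizedHilferPrabhakar, prabhakarIntegral_congr ht fun s hs =>
    eqOn_prabhakarIntegral_deriv_solutionSeries hρ hμ h2 hs.1, prabhakarIntegral_const_mul,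
    prabhakarIntegral_prabhakarSeries _ _ _ _ _ hρ hμ (add_pos_of_nonneg_of_pos h2 hμ) h1 ht,
    solutionSeries_eq]
  congr 2 <;> ring

end Solution

/-! ### Convolution on the half-line and the Volterra equation -/

noncomputable section

/-- The convolution `∫₀ᵗ f(t-y) g(y) dy` of functions on the half-line. -/
def causalConv (f g : ℝ → ℂ) (t : ℝ) : ℂ := ∫ y in (0 : ℝ)..t, f (t - y) * g y

end

section Convolution

open scoped Convolution

open ContinuousLinearMap (mul)

variable {f g h : ℝ → ℂ} {b : ℝ}

theorem causalConv_comm (f g : ℝ → ℂ) : causalConv f g = causalConv g f := by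
  funext t
  have := intervalIntegral.integral_comp_sub_left (a := 0) (b := t)
    (fun y => f (t - y) * g y) t
  simp only [sub_sub_cancel, sub_self, sub_zero] at this
  rw [causalConv, ← this, causalConv]
  simp only [mul_comm]

/-- For `t ≤ b` the two cut-offs leave exactly `0 < y < t`. Thus, up to `b`, causal convolution is
the convolution on `ℝ` of truncated functions, and the Fubini-type results for the latter apply. -/
theorem indicator_sub_mul_indicator {t : ℝ} (ht : t ≤ b) (f g : ℝ → ℂ) (y : ℝ) :
    (Ioo 0 b).indicator f (t - y) * (Ioo 0 b).indicator g y =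
      (Ioo 0 t).indicator (fun y => f (t - y) * g y) y := by
  by_cases hy : y ∈ Ioo 0 t
  · rw [indicator_of_mem hy, indicator_of_mem, indicator_of_mem]
    · exact ⟨hy.1, hy.2.trans_le ht⟩
    · exact ⟨sub_pos.2 hy.2, by linarith [hy.1]⟩
  · rw [indicator_of_notMem hy]
    by_cases hy0 : 0 < y
    · rw [indicator_of_notMem (fun h' => hy ⟨hy0, sub_pos.1 h'.1⟩), zero_mul]
    · rw [indicator_of_notMem (fun h' => hy0 h'.1) g, mul_zero]

theorem convolution_indicator {t : ℝ} (ht0 : 0 ≤ t) (ht : t ≤ b) :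
    ((Ioo 0 b).indicator f ⋆[mul ℂ ℂ, volume] (Ioo 0 b).indicator g) t = causalConv f g t := by
  rw [convolution_mul_swap]
  simp only [indicator_sub_mul_indicator ht]
  rw [integral_indicator measurableSet_Ioo, causalConv, intervalIntegral.integral_of_le ht0,
    integral_Ioc_eq_integral_Ioo]

theorem convolution_indicator_of_nonpos {t : ℝ} (ht : t ≤ 0) (hb : 0 ≤ b) :
    ((Ioo 0 b).indicator f ⋆[mul ℂ ℂ, volume] (Ioo 0 b).indicator g) t = 0 := by
  rw [convolution_mul_swap]
  simp only [indicator_sub_mul_indicator (ht.trans hb), Ioo_eq_empty_of_le ht, indicator_empty,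
    integral_zero]

theorem integrable_indicator_Ioo (hb : 0 ≤ b) (hf : IntervalIntegrable f volume 0 b) :
    Integrable ((Ioo 0 b).indicator f) :=
  (integrable_indicator_iff measurableSet_Ioo).2
    ((intervalIntegrable_iff_integrableOn_Ioo_of_le hb).1 hf)

theorem intervalIntegrable_causalConv (hb : 0 ≤ b) (hf : IntervalIntegrable f volume 0 b)
    (hg : IntervalIntegrable g volume 0 b) : IntervalIntegrable (causalConv f g) volume 0 b := by
  rw [intervalIntegrable_iff_integrableOn_Ioo_of_le hb]
  have h := (integrable_indicator_Ioo hb hf).integrable_convolution (mul ℂ ℂ)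
    (integrable_indicator_Ioo hb hg)
  exact h.integrableOn.congr_fun (fun t ht => convolution_indicator ht.1.le ht.2.le)
    measurableSet_Ioo

theorem ae_intervalIntegrable_causalConv (hb : 0 ≤ b) (hf : IntervalIntegrable f volume 0 b)
    (hg : IntervalIntegrable g volume 0 b) :
    ∀ᵐ t : ℝ, t ∈ Ioo 0 b → IntervalIntegrable (fun y => f (t - y) * g y) volume 0 t := by
  filter_upwards [(integrable_indicator_Ioo hb hf).ae_convolution_exists (mul ℂ ℂ)
    (integrable_indicator_Ioo hb hg)] with t ht htb
  have h := ht.integrable_swap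
  simp only [ContinuousLinearMap.mul_apply', indicator_sub_mul_indicator htb.2.le] at h
  rw [intervalIntegrable_iff_integrableOn_Ioo_of_le htb.1.le]
  exact (integrable_indicator_iff measurableSet_Ioo).1 h

theorem causalConv_assoc (hb : 0 ≤ b) (hf : IntervalIntegrable f volume 0 b)
    (hg : IntervalIntegrable g volume 0 b) (hh : IntervalIntegrable h volume 0 b) :
    ∀ᵐ t : ℝ, t ∈ Ioo 0 b → causalConv (causalConv f g) h t = causalConv f (causalConv g h) t := by
  have hF := integrable_indicator_Ioo hb hf
  have hG := integrable_indicator_Ioo hb hg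
  have hH := integrable_indicator_Ioo hb hh
  -- Beyond `b` the convolution of truncations need not agree with the truncated `causalConv`, but
  -- there `t - y < 0` and the outer factor vanishes; for `y ≤ 0` both are zero.
  have key : ∀ {t : ℝ} (u v w : ℝ → ℂ), t ∈ Ioo 0 b → ∀ y,
      (Ioo 0 b).indicator u (t - y) *
        ((Ioo 0 b).indicator v ⋆[mul ℂ ℂ, volume] (Ioo 0 b).indicator w) y =
      (Ioo 0 t).indicator (fun y => u (t - y) * causalConv v w y) y := by
    intro t u v w ht y
    rw [← indicator_sub_mul_indicator ht.2.le u (causalConv v w) y]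
    by_cases hyt : y < t
    · rcases le_or_gt y 0 with hy | hy
      · rw [convolution_indicator_of_nonpos hy hb, indicator_of_notMem (fun h' => hy.not_gt h'.1)
          (causalConv v w)]
      · have hyb : y < b := hyt.trans ht.2
        rw [convolution_indicator hy.le hyb.le,
          indicator_of_mem (show y ∈ Ioo 0 b from ⟨hy, hyb⟩) (causalConv v w)]
    · rw [indicator_of_notMem (fun h' => hyt (sub_pos.1 h'.1)), zero_mul, zero_mul]
  filter_upwards [hF.norm.ae_convolution_exists (mul ℝ ℝ)
    (hG.norm.integrable_convolution (mul ℝ ℝ) hH.norm)] with t ht htb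
  have hA := convolution_assoc (mul ℂ ℂ) (mul ℂ ℂ) (mul ℂ ℂ) (mul ℂ ℂ)
    (fun x y z => mul_assoc x y z) hF.1 hG.1 hH.1 (hF.ae_convolution_exists (mul ℂ ℂ) hG)
    (hG.norm.ae_convolution_exists (mul ℝ ℝ) hH.norm) ht
  have e2 : ((Ioo 0 b).indicator f ⋆[mul ℂ ℂ, volume] ((Ioo 0 b).indicator g ⋆[mul ℂ ℂ, volume]
      (Ioo 0 b).indicator h)) t = causalConv f (causalConv g h) t := by
    rw [convolution_mul_swap]
    simp only [key f g h htb]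
    rw [integral_indicator measurableSet_Ioo, causalConv,
      intervalIntegral.integral_of_le htb.1.le, integral_Ioc_eq_integral_Ioo]
  have e1 : (((Ioo 0 b).indicator f ⋆[mul ℂ ℂ, volume] (Ioo 0 b).indicator g)
      ⋆[mul ℂ ℂ, volume] (Ioo 0 b).indicator h) t = causalConv (causalConv f g) h t := by
    rw [convolution_mul, causalConv_comm]
    simp only [mul_comm _ ((Ioo 0 b).indicator h _), key h f g htb]
    rw [integral_indicator measurableSet_Ioo, causalConv,
      intervalIntegral.integral_of_le htb.1.le, integral_Ioc_eq_integral_Ioo]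
  rw [← e1, ← e2, hA]

theorem causalConv_congr_left {f₁ f₂ : ℝ → ℂ} {t : ℝ} (ht : 0 ≤ t) (h : EqOn f₁ f₂ (Ioo 0 t)) :
    causalConv f₁ g t = causalConv f₂ g t :=
  intervalIntegral.integral_congr_Ioo_of_le ht fun y hy => by
    simp only [h (show t - y ∈ Ioo 0 t from ⟨sub_pos.2 hy.2, by linarith [hy.1]⟩)]

theorem causalConv_congr_right {g₁ g₂ : ℝ → ℂ} {t : ℝ} (ht0 : 0 ≤ t) (ht : t ≤ b)
    (h : ∀ᵐ y : ℝ, y ∈ Ioo 0 b → g₁ y = g₂ y) : causalConv f g₁ t = causalConv f g₂ t := by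
  rw [causalConv, causalConv, intervalIntegral.integral_of_le ht0,
    intervalIntegral.integral_of_le ht0, integral_Ioc_eq_integral_Ioo,
    integral_Ioc_eq_integral_Ioo]
  refine setIntegral_congr_ae measurableSet_Ioo ?_
  filter_upwards [h] with y hy hy'
  rw [hy ⟨hy'.1, hy'.2.trans_le ht⟩]

open Filter Topology in
-- With the weight `exp(-nt)` the kernel becomes `k(s) exp(-ns)`, whose `L¹` norm on `(0,b)` tends
-- to `0` by dominated convergence. Once it is below `1/2`, the weighted supremum of `h` is at most
-- half of itself.
theorem eqOn_zero_of_eq_causalConv {k : ℝ → ℂ} (hb : 0 < b)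
    (hk : IntervalIntegrable k volume 0 b) (hh : ContinuousOn h (Icc 0 b))
    (heq : ∀ᵐ t : ℝ, t ∈ Ioo 0 b → h t = causalConv k h t) : EqOn h 0 (Icc 0 b) := by
  have hlim : Tendsto (fun n : ℕ => ∫ s in (0 : ℝ)..b, ‖k s‖ * Real.exp (-(n * s))) atTop
      (𝓝 (∫ s in (0 : ℝ)..b, 0)) := by
    refine intervalIntegral.tendsto_integral_filter_of_dominated_convergence (fun s => ‖k s‖)
      (Eventually.of_forall fun n => ?_) (Eventually.of_forall fun n => ?_) hk.norm ?_
    · exact (intervalIntegrable_iff.1 hk.norm).1.mul (by fun_prop)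
    · refine Eventually.of_forall fun s hs => ?_
      rw [uIoc_of_le hb.le] at hs
      rw [norm_mul, norm_norm, Real.norm_of_nonneg (Real.exp_pos _).le]
      refine mul_le_of_le_one_right (norm_nonneg _) (Real.exp_le_one_iff.2 ?_)
      have := hs.1.le
      simp only [Left.neg_nonpos_iff]
      positivity
    · refine Eventually.of_forall fun s hs => ?_
      rw [uIoc_of_le hb.le] at hs
      rw [← mul_zero ‖k s‖]
      refine Tendsto.const_mul _ (Real.tendsto_exp_neg_atTop_nhds_zero.comp ?_)
      exact tendsto_natCast_atTop_atTop.atTop_mul_const hs.1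
  rw [intervalIntegral.integral_zero] at hlim
  obtain ⟨n, hn⟩ := (hlim.eventually (gt_mem_nhds one_half_pos)).exists
  have hkn : IntervalIntegrable (fun s => ‖k s‖ * Real.exp (-(n * s))) volume 0 b :=
    hk.norm.mul_continuousOn (by fun_prop)
  set φ : ℝ → ℝ := fun t => ‖h t‖ * Real.exp (-(n * t)) with hφ
  have hφc : ContinuousOn φ (Icc 0 b) := hh.norm.mul (by fun_prop)
  obtain ⟨t₁, ht₁, hmax⟩ := isCompact_Icc.exists_isMaxOn ⟨0, left_mem_Icc.2 hb.le⟩ hφc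
  have hM : 0 ≤ φ t₁ := by positivity
  have hae : ∀ᵐ t : ℝ, t ∈ Ioo 0 b → φ t ≤ φ t₁ / 2 := by
    filter_upwards [heq] with t ht htb
    have hsub : uIcc 0 t ⊆ uIcc 0 b := uIcc_subset_uIcc_left (by
      rw [uIcc_of_le hb.le]; exact Ioo_subset_Icc_self htb)
    have hint := hkn.mono_set hsub
    have hint' := hint.comp_sub_left t
    rw [sub_self, sub_zero] at hint'
    have hbound : ‖causalConv k h t‖ ≤ ∫ y in (0 : ℝ)..t,
        Real.exp (n * t) * φ t₁ * (‖k (t - y)‖ * Real.exp (-(n * (t - y)))) := by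
      refine intervalIntegral.norm_integral_le_of_norm_le htb.1.le ?_
        (hint'.symm.const_mul _)
      refine Eventually.of_forall fun y hy => ?_
      have hy' : φ y ≤ φ t₁ := hmax ⟨hy.1.le, hy.2.trans htb.2.le⟩
      have e : ‖h y‖ = φ y * Real.exp (n * y) := by
        rw [hφ]
        simp only
        rw [mul_assoc, ← Real.exp_add, neg_add_cancel, Real.exp_zero, mul_one]
      have e' : Real.exp (n * t) * Real.exp (-(n * (t - y))) = Real.exp (n * y) := by
        rw [← Real.exp_add]; congr 1; ring
      rw [norm_mul, e]
      calc ‖k (t - y)‖ * (φ y * Real.exp (n * y)) ≤ ‖k (t - y)‖ * (φ t₁ * Real.exp (n * y)) := by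
            gcongr
        _ = _ := by rw [← e']; ring
    rw [intervalIntegral.integral_const_mul,
      intervalIntegral.integral_comp_sub_left (fun s => ‖k s‖ * Real.exp (-(n * s))),
      sub_self, sub_zero] at hbound
    have hle : ∫ s in (0 : ℝ)..t, ‖k s‖ * Real.exp (-(n * s)) ≤ 1 / 2 := by
      refine le_trans ?_ hn.le
      exact intervalIntegral.integral_mono_interval le_rfl htb.1.le htb.2.le
        (Eventually.of_forall fun s => by positivity) hkn
    have hexp : Real.exp (n * t) * Real.exp (-(n * t)) = 1 := by
      rw [← Real.exp_add, add_neg_cancel, Real.exp_zero]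
    calc φ t = ‖causalConv k h t‖ * Real.exp (-(n * t)) := by rw [hφ]; simp only; rw [ht htb]
      _ ≤ (Real.exp (n * t) * φ t₁ * (1 / 2)) * Real.exp (-(n * t)) := by
          gcongr
          exact hbound.trans (by gcongr)
      _ = φ t₁ / 2 * (Real.exp (n * t) * Real.exp (-(n * t))) := by ring
      _ = φ t₁ / 2 := by rw [hexp, mul_one]
  -- The maximum point `t₁` may be an endpoint or an exceptional point, so the a.e. inequality is
  -- extended by continuity, phrased as an equality of continuous functions.
  have hall : EqOn (fun t => min (φ t) (φ t₁ / 2)) φ (Icc 0 b) := by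
    refine Measure.eqOn_Icc_of_ae_eq volume hb.ne ?_ (hφc.inf continuousOn_const) hφc
    rw [Filter.EventuallyEq, ← restrict_Ioo_eq_restrict_Icc, ae_restrict_iff' measurableSet_Ioo]
    exact hae.mono fun t ht htb => min_eq_left (ht htb)
  have hM0 : φ t₁ ≤ φ t₁ / 2 := min_eq_left_iff.1 (hall ht₁)
  intro t ht
  have h1 : φ t ≤ 0 := (hmax ht).trans (by linarith)
  have h2 : ‖h t‖ ≤ 0 := nonpos_of_mul_nonpos_left h1 (Real.exp_pos _)
  simpa using h2

end Convolution

/-! ### Reduction to a Volterra equation and uniqueness -/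

section Uniqueness

variable {ρ μ₁ μ₂ b : ℝ} {f g : ℝ → ℂ}

theorem intervalIntegrable_prabhakarKernel (ω γ : ℝ) (hρ : 0 < ρ) (hμ₁ : 0 ≤ μ₁) (hb : 0 < b) :
    IntervalIntegrable (fun s => (prabhakarKernel ρ μ₁ ω γ s : ℂ)) volume 0 b := by
  have h := intervalIntegrable_prabhakarKernel_mul ω 0 γ hρ zero_le_one hμ₁ hb
  simp only [prabhakarKernel_one_zero, one_mul] at h
  exact h.complex_ofReal

theorem prabhakarIntegral_eq_causalConv (ρ μ₁ ω γ : ℝ) (f : ℝ → ℂ) (t : ℝ) :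
    prabhakarIntegral ρ μ₁ ω γ f t =
      (if μ₁ = 0 then f t else 0) + causalConv (fun s => (prabhakarKernel ρ μ₁ ω γ s : ℂ)) f t :=
  rfl

theorem prabhakarIntegral_of_pos (ω γ : ℝ) (hμ₁ : 0 < μ₁) :
    prabhakarIntegral ρ μ₁ ω γ f =
      causalConv (fun s => (prabhakarKernel ρ μ₁ ω γ s : ℂ)) f := by
  funext t
  rw [prabhakarIntegral_eq_causalConv, if_neg hμ₁.ne', zero_add]

theorem intervalIntegrable_prabhakarIntegral (ω γ : ℝ) (hρ : 0 < ρ) (hμ₁ : 0 ≤ μ₁) (hb : 0 < b)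
    (hf : IntervalIntegrable f volume 0 b) :
    IntervalIntegrable (prabhakarIntegral ρ μ₁ ω γ f) volume 0 b := by
  have h := intervalIntegrable_causalConv hb.le
    (intervalIntegrable_prabhakarKernel ω γ hρ hμ₁ hb) hf
  by_cases h0 : μ₁ = 0
  · exact (hf.add h).congr fun t _ => by
      rw [prabhakarIntegral_eq_causalConv, if_pos h0]
  · exact h.congr fun t _ => by rw [prabhakarIntegral_eq_causalConv, if_neg h0, zero_add]

theorem causalConv_prabhakarKernel (ω γ₁ γ₂ : ℝ) (hρ : 0 < ρ) (hμ₁ : 0 ≤ μ₁) (hμ₂ : 0 < μ₂)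
    {t : ℝ} (ht : 0 < t) :
    (if μ₁ = 0 then (prabhakarKernel ρ μ₂ ω γ₂ t : ℂ) else 0) +
      causalConv (fun s => (prabhakarKernel ρ μ₂ ω γ₂ s : ℂ))
        (fun s => (prabhakarKernel ρ μ₁ ω γ₁ s : ℂ)) t =
      (prabhakarKernel ρ (μ₁ + μ₂) ω (γ₁ + γ₂) t : ℂ) := by
  rw [causalConv_comm, causalConv, ← prabhakarKernel_conv ω γ₁ γ₂ hρ hμ₁ hμ₂ ht]
  simp only [← Complex.ofReal_mul]
  rw [intervalIntegral.integral_ofReal]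
  split_ifs <;> simp

/-- The semigroup property of the Prabhakar integrals on integrable functions. -/
theorem ae_prabhakarIntegral_prabhakarIntegral (ω γ₁ γ₂ : ℝ) (hρ : 0 < ρ) (hμ₁ : 0 ≤ μ₁)
    (hμ₂ : 0 < μ₂) (hb : 0 < b) (hf : IntervalIntegrable f volume 0 b) :
    ∀ᵐ t : ℝ, t ∈ Ioo 0 b →
      prabhakarIntegral ρ μ₂ ω γ₂ (prabhakarIntegral ρ μ₁ ω γ₁ f) t =
        prabhakarIntegral ρ (μ₁ + μ₂) ω (γ₁ + γ₂) f t := by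
  have hk₁ := intervalIntegrable_prabhakarKernel ω γ₁ hρ hμ₁ hb
  have hk₂ := intervalIntegrable_prabhakarKernel ω γ₂ hρ hμ₂.le hb
  have hk := intervalIntegrable_causalConv hb.le hk₂ hk₁
  filter_upwards [causalConv_assoc hb.le hk₂ hk₁ hf, ae_intervalIntegrable_causalConv hb.le hk₂ hf,
    ae_intervalIntegrable_causalConv hb.le hk₂ (intervalIntegrable_causalConv hb.le hk₁ hf),
    ae_intervalIntegrable_causalConv hb.le hk hf] with t hassoc h1 h2 h3 ht
  rw [prabhakarIntegral_of_pos ω γ₂ hμ₂,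
    prabhakarIntegral_of_pos ω _ (add_pos_of_nonneg_of_pos hμ₁ hμ₂),
    ← causalConv_congr_left ht.1.le fun s hs => causalConv_prabhakarKernel ω γ₁ γ₂ hρ hμ₁ hμ₂ hs.1,
    funext (prabhakarIntegral_eq_causalConv ρ μ₁ ω γ₁ f)]
  -- If `μ₁ = 0` the Dirac mass contributes an extra `f` inside and an extra kernel on the other
  -- side; splitting the integrals needs the integrability known for almost every `t`.
  by_cases h0 : μ₁ = 0
  · simp only [if_pos h0]
    calc _ = causalConv (fun s => (prabhakarKernel ρ μ₂ ω γ₂ s : ℂ)) f t +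
          causalConv (fun s => (prabhakarKernel ρ μ₂ ω γ₂ s : ℂ))
            (causalConv (fun s => (prabhakarKernel ρ μ₁ ω γ₁ s : ℂ)) f) t := by
          simp only [causalConv] at h2 ⊢
          rw [← intervalIntegral.integral_add (h1 ht) (h2 ht)]
          simp only [mul_add]
      _ = _ := by
          rw [← hassoc ht]
          have h1 := h1 ht
          have h3 := h3 ht
          simp only [causalConv] at h3 ⊢
          rw [← intervalIntegral.integral_add h1 h3]
          simp only [add_mul]
  · simp only [if_neg h0, zero_add]
    exact (hassoc ht).symm

/-- The operator of order `μ` and parameter `γ` undoes the derivative: composed with it, the orders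
sum to `1` and the parameters to `0`, leaving `∫₀ᵗ g' = g(t) - g(0)`. -/
theorem ae_eq_add_causalConv_of_regularizedHilferPrabhakar_eq {ω γ μ ν : ℝ} {c : ℂ} (hρ : 0 < ρ)
    (hμ : 0 < μ) (hμ1 : μ ≤ 1) (hν : 0 ≤ ν) (hν1 : ν ≤ 1) (hb : 0 < b)
    (hg : AbsolutelyContinuousOnInterval g 0 b)
    (heq : ∀ᵐ t : ℝ, t ∈ Ioo 0 b → regularizedHilferPrabhakar ρ ω γ μ ν g t = c * g t) :
    ∀ᵐ t : ℝ, t ∈ Ioo 0 b →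
      g t = g 0 + c * causalConv (fun s => (prabhakarKernel ρ μ ω γ s : ℂ)) g t := by
  have h1 : 0 ≤ ν * (1 - μ) := mul_nonneg hν (sub_nonneg.2 hμ1)
  have h2 : 0 ≤ (1 - ν) * (1 - μ) := mul_nonneg (sub_nonneg.2 hν1) (sub_nonneg.2 hμ1)
  have hg' := hg.intervalIntegrable_deriv_complex
  -- The semigroup law is available for an outer operator of positive order, so the order `μ`
  -- operator, placed outermost, is merged first with the `ν(1-μ)` one and the result with the
  -- remaining one.
  filter_upwards [ae_prabhakarIntegral_prabhakarIntegral ω (-γ * ν) γ hρ h1 hμ hb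
      (intervalIntegrable_prabhakarIntegral ω (-γ * (1 - ν)) hρ h2 hb hg'),
    ae_prabhakarIntegral_prabhakarIntegral ω (-γ * (1 - ν)) (-γ * ν + γ) hρ h2
      (add_pos_of_nonneg_of_pos h1 hμ) hb hg'] with t e1 e2 ht
  have e3 := (e1 ht).trans (e2 ht)
  rw [show (1 - ν) * (1 - μ) + (ν * (1 - μ) + μ) = 1 by ring,
    show -γ * (1 - ν) + (-γ * ν + γ) = 0 by ring, prabhakarIntegral_one_zero,
    (hg.mono (uIcc_subset_uIcc_left (by
      rw [uIcc_of_le hb.le]; exact Ioo_subset_Icc_self ht))).integral_deriv_eq_sub_complex] at e3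
  have e4 : prabhakarIntegral ρ μ ω γ (fun s => c * g s) t = g t - g 0 := by
    rw [← e3, prabhakarIntegral_of_pos ω γ hμ, prabhakarIntegral_of_pos ω γ hμ]
    exact (causalConv_congr_right ht.1.le ht.2.le heq).symm
  rw [prabhakarIntegral_const_mul, prabhakarIntegral_of_pos ω γ hμ] at e4
  rw [e4]
  ring

theorem eqOn_of_regularizedHilferPrabhakar_eq {ω γ μ ν : ℝ} {c : ℂ} {g₁ g₂ : ℝ → ℂ} (hρ : 0 < ρ)
    (hμ : 0 < μ) (hμ1 : μ ≤ 1) (hν : 0 ≤ ν) (hν1 : ν ≤ 1) (hb : 0 < b)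
    (hg₁ : AbsolutelyContinuousOnInterval g₁ 0 b) (hg₂ : AbsolutelyContinuousOnInterval g₂ 0 b)
    (heq₁ : ∀ᵐ t : ℝ, t ∈ Ioo 0 b → regularizedHilferPrabhakar ρ ω γ μ ν g₁ t = c * g₁ t)
    (heq₂ : ∀ᵐ t : ℝ, t ∈ Ioo 0 b → regularizedHilferPrabhakar ρ ω γ μ ν g₂ t = c * g₂ t)
    (h0 : g₁ 0 = g₂ 0) : EqOn g₁ g₂ (Icc 0 b) := by
  have hk := intervalIntegrable_prabhakarKernel ω γ hρ hμ.le hb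
  have hc₁ := hg₁.continuousOn
  have hc₂ := hg₂.continuousOn
  have hi₁ : IntervalIntegrable g₁ volume 0 b := hc₁.intervalIntegrable
  have hi₂ : IntervalIntegrable g₂ volume 0 b := hc₂.intervalIntegrable
  rw [uIcc_of_le hb.le] at hc₁ hc₂
  have hz := eqOn_zero_of_eq_causalConv (k := fun s => c * (prabhakarKernel ρ μ ω γ s : ℂ))
    (h := fun t => g₁ t - g₂ t) hb (hk.const_mul c) (hc₁.sub hc₂) <| by
    filter_upwards [ae_intervalIntegrable_causalConv hb.le hk hi₁,
      ae_intervalIntegrable_causalConv hb.le hk hi₂,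
      ae_eq_add_causalConv_of_regularizedHilferPrabhakar_eq hρ hμ hμ1 hν hν1 hb hg₁ heq₁,
      ae_eq_add_causalConv_of_regularizedHilferPrabhakar_eq hρ hμ hμ1 hν hν1 hb hg₂ heq₂]
      with t i1 i2 e1 e2 ht
    rw [e1 ht, e2 ht, h0, add_sub_add_left_eq_sub, ← mul_sub]
    simp only [causalConv]
    rw [← intervalIntegral.integral_sub (i1 ht) (i2 ht), ← intervalIntegral.integral_const_mul]
    congr 1
    funext y
    ring
  exact fun t ht => sub_eq_zero.1 (hz ht)

end Uniqueness

theorem theorem4p2 (ρ ω γ μ ν lam : ℝ) (hρ : 0 < ρ) (hρ1 : ρ ≤ 1) (hμ : 0 < μ) (hμ1 : μ ≤ 1)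
    (hν : 0 ≤ ν) (hν1 : ν ≤ 1) (hγ : 0 ≤ γ) (hlam : 0 < lam) (v : ℂ) (hv : ‖v‖ ≤ 1) :
    -- the series converges
    (∀ t : ℝ, 0 ≤ t → Summable (solutionTerm ρ ω γ μ lam v t)) ∧
    -- its sum solves the Cauchy problem
    (∀ b : ℝ, 0 < b → AbsolutelyContinuousOnInterval (solutionSeries ρ ω γ μ lam v) 0 b) ∧
    RegularizedHilferPrabhakarExists ρ (-ω) γ μ ν (solutionSeries ρ ω γ μ lam v) ∧
    (∀ t : ℝ, 0 < t →
      regularizedHilferPrabhakar ρ (-ω) γ μ ν (solutionSeries ρ ω γ μ lam v) t =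
        -(lam : ℂ) * (1 - v) * solutionSeries ρ ω γ μ lam v t) ∧
    solutionSeries ρ ω γ μ lam v 0 = 1 ∧
    -- it is the only solution, on every interval
    (∀ b : ℝ, 0 < b → ∀ g : ℝ → ℂ, AbsolutelyContinuousOnInterval g 0 b →
      (∀ᵐ t : ℝ, t ∈ Ioo 0 b →
        regularizedHilferPrabhakar ρ (-ω) γ μ ν g t = -(lam : ℂ) * (1 - v) * g t) →
      g 0 = 1 →
      ∀ t ∈ Icc 0 b, g t = solutionSeries ρ ω γ μ lam v t) := by
  have hAC : ∀ b : ℝ, 0 < b →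
      AbsolutelyContinuousOnInterval (solutionSeries ρ ω γ μ lam v) 0 b := fun b hb =>
    absolutelyContinuousOnInterval_solutionSeries hρ hμ hb
  refine ⟨fun t ht => summable_solutionTerm hρ hμ ht, hAC,
    regularizedHilferPrabhakarExists_solutionSeries hρ hμ hμ1 hν hν1,
    fun t ht => regularizedHilferPrabhakar_solutionSeries hρ hμ hμ1 hν hν1 ht,
    solutionSeries_zero hμ, fun b hb g hg heq hg0 => ?_⟩
  refine eqOn_of_regularizedHilferPrabhakar_eq hρ hμ hμ1 hν hν1 hb hg (hAC b hb) heq ?_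
    (hg0.trans (solutionSeries_zero hμ).symm)
  exact Filter.Eventually.of_forall fun t ht =>
    regularizedHilferPrabhakar_solutionSeries hρ hμ hμ1 hν hν1 ht.1
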